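/- Let $H$ be a Lie group with group $Aut(H)$ of smooth automorphisms and let $p:E\to M$ be an $H$ principal bibundle, i.e. a smooth bundle that is both a left and a right principal $H$-bundle, with commuting left action $(h,e)\mapsto he=l^h(e)$ and right action $(e,h)\mapsto e\triangleleft h=r^h(e)$. For $e\in E$ let $\boldsymbol\varphi_e\in Aut(H)$ be the automorphism defined by $\boldsymbol\varphi_e(h)\,e=e\triangleleft h$; its differential on $\mathrm{Lie}(H)$ is denoted by the same symbol. Write $[\,c(t)\,]$ for the velocity at $t=0$ of a curve $c$. For $X\in \mathrm{Lie}(Aut(H))$ put $T_X(h)=[\,h\,e^{tX}(h^{-1})\,]\in \mathrm{Lie}(H)$, and for a $\mathrm{Lie}(Aut(H))$-valued one-form $A$ let $T_A(h)$ be the $\mathrm{Lie}(H)$-valued one-form $v\mapsto T_{A(v)}(h)$. For $Y=[g(t)]\in\mathrm{Lie}(H)$ put $ad_Y=[Ad_{g(t)}]\in \mathrm{Lie}(Aut(H))$. A (left) 2-connection on $E$ is a pair $(\mathbf a,A)$ of a smooth $\mathrm{Lie}(H)$-valued one-form $\mathbf a$ on $E$ and a smooth $\mathrm{Lie}(Aut(H))$-valued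 one-form $A$ on $M$ such that, for all smooth curves $g(t)$ in $H$ with $g(0)=1$, all $e\in E$ and all $h\in H$, $$\mathbf a[g(t)e]=-[g(t)],\qquad l^{h*}\mathbf a=Ad_h\mathbf a+p^*T_A(h).$$ Theorem. Let $(\mathbf a,A)$ be a 2-connection on $E$. Then there is a unique $\mathrm{Lie}(Aut(H))$-valued one-form $A^r$ on $M$ such that $$p^*A^r=\boldsymbol\varphi^{-1}(p^*A+ad_{\mathbf a})\boldsymbol\varphi+\boldsymbol\varphi^{-1}d\boldsymbol\varphi ,$$ where, at $v=[\gamma(t)]\in T_eE$, $\boldsymbol\varphi^{-1}X\boldsymbol\varphi=[\boldsymbol\varphi_e^{-1}\circ e^{tX}\circ\boldsymbol\varphi_e]$ for $X\in \mathrm{Lie}(Aut(H))$, and $(\boldsymbol\varphi^{-1}d\boldsymbol\varphi)(v)=[\boldsymbol\varphi_e^{-1}\circ\boldsymbol\varphi_{\gamma(t)}]$. The form $A^r$ is smooth, and with the one-form $\mathbf a^r=-\boldsymbol\varphi^{-1}(\mathbf a)$ (that is, $\mathbf a^r(v)=-\boldsymbol\varphi_e^{-1}(\mathbf a(v))$ for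 $v\in T_eE$) the pair $(\mathbf a^r,A^r)$ is a right 2-connection: $\mathbf a^r$ is a smooth $\mathrm{Lie}(H)$-valued one-form on $E$ and, for all smooth curves $g(t)$ in $H$ with $g(0)=1$, all $e\in E$ and all $h\in H$, $$\mathbf a^r[e\triangleleft g(t)]=[g(t)],\qquad r^{h*}\mathbf a^r=Ad_{h^{-1}}\mathbf a^r+p^*T_{A^r}(h^{-1}).$$ -/

import Mathlib

open scoped Manifold ContDiff RightActions

noncomputable section

namespace Bibundle

/-! ### Principal bibundles -/

section Bundles

variable (EH EM EE : Type*)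
  [NormedAddCommGroup EH] [NormedSpace ℝ EH]
  [NormedAddCommGroup EM] [NormedSpace ℝ EM]
  [NormedAddCommGroup EE] [NormedSpace ℝ EE]
  {H M E : Type*}
  [TopologicalSpace H] [ChartedSpace EH H] [Group H]
  [TopologicalSpace M] [ChartedSpace EM M]
  [TopologicalSpace E] [ChartedSpace EE E]

/-- `p : E → M` is a smooth left principal `H`-bundle: `H` acts smoothly on the left of `E`
preserving the fibres, and `E` is locally (over open sets `U` of `M`) equivariantly
diffeomorphic to `U × H`, where `H` acts on `U × H` by left multiplication on `H`. -/
structure IsLeftPrincipalBundle [MulAction H E] (p : E → M) : Prop where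
  contMDiff_proj : ContMDiff 𝓘(ℝ, EE) 𝓘(ℝ, EM) ∞ p
  contMDiff_smul :
    ContMDiff (𝓘(ℝ, EH).prod 𝓘(ℝ, EE)) 𝓘(ℝ, EE) ∞ (fun q : H × E => q.1 • q.2)
  proj_smul : ∀ (h : H) (e : E), p (h • e) = p e
  exists_trivialization : ∀ x : M, ∃ U : Set M, IsOpen U ∧ x ∈ U ∧
    ∃ Φ : OpenPartialHomeomorph E (M × H),
      Φ.source = p ⁻¹' U ∧ Φ.target = U ×ˢ Set.univ ∧
      ContMDiffOn 𝓘(ℝ, EE) (𝓘(ℝ, EM).prod 𝓘(ℝ, EH)) ∞ Φ Φ.source ∧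
      ContMDiffOn (𝓘(ℝ, EM).prod 𝓘(ℝ, EH)) 𝓘(ℝ, EE) ∞ Φ.symm Φ.target ∧
      (∀ e ∈ Φ.source, (Φ e).1 = p e) ∧
      ∀ e ∈ Φ.source, ∀ h : H, (Φ (h • e)).2 = h * (Φ e).2

/-- `p : E → M` is a smooth right principal `H`-bundle. The right action `e ◁ h` is the action of
the opposite group, written `e <• h`. -/
structure IsRightPrincipalBundle [MulAction Hᵐᵒᵖ E] (p : E → M) : Prop where
  contMDiff_proj : ContMDiff 𝓘(ℝ, EE) 𝓘(ℝ, EM) ∞ p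
  contMDiff_smul :
    ContMDiff (𝓘(ℝ, EE).prod 𝓘(ℝ, EH)) 𝓘(ℝ, EE) ∞ (fun q : E × H => q.1 <• q.2)
  proj_smul : ∀ (e : E) (h : H), p (e <• h) = p e
  exists_trivialization : ∀ x : M, ∃ U : Set M, IsOpen U ∧ x ∈ U ∧
    ∃ Φ : OpenPartialHomeomorph E (M × H),
      Φ.source = p ⁻¹' U ∧ Φ.target = U ×ˢ Set.univ ∧
      ContMDiffOn 𝓘(ℝ, EE) (𝓘(ℝ, EM).prod 𝓘(ℝ, EH)) ∞ Φ Φ.source ∧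
      ContMDiffOn (𝓘(ℝ, EM).prod 𝓘(ℝ, EH)) 𝓘(ℝ, EE) ∞ Φ.symm Φ.target ∧
      (∀ e ∈ Φ.source, (Φ e).1 = p e) ∧
      ∀ e ∈ Φ.source, ∀ h : H, (Φ (e <• h)).2 = (Φ e).2 * h

/-- An `H` principal bibundle: a left and right principal `H`-bundle with the same projection,
whose left and right actions commute. -/
structure IsPrincipalBibundle (H : Type*) [TopologicalSpace H] [ChartedSpace EH H] [Group H]
    [MulAction H E] [MulAction Hᵐᵒᵖ E] (p : E → M) : Prop where
  left : IsLeftPrincipalBundle EH EM EE (H := H) p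
  right : IsRightPrincipalBundle EH EM EE (H := H) p
  smul_comm : ∀ (k h : H) (e : E), (k • e) <• h = k • (e <• h)

variable {EH EM EE}

theorem IsLeftPrincipalBundle.existsUnique_smul [MulAction H E] {p : E → M}
    (hp : IsLeftPrincipalBundle EH EM EE (H := H) p) {e e' : E} (h : p e' = p e) :
    ∃! k : H, k • e = e' := by
  obtain ⟨U, -, hxU, Φ, hs, -, -, -, h1, h2⟩ := hp.exists_trivialization (p e)
  have he : e ∈ Φ.source := by rw [hs]; exact hxU
  have he' : e' ∈ Φ.source := by rw [hs]; show p e' ∈ U; rw [h]; exact hxU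
  have hk : ∀ k : H, k • e ∈ Φ.source := fun k => by
    rw [hs]; show p (k • e) ∈ U; rw [hp.proj_smul]; exact hxU
  refine ⟨(Φ e').2 * (Φ e).2⁻¹, ?_, ?_⟩
  · apply Φ.injOn (hk _) he'
    ext
    · rw [h1 _ (hk _), h1 _ he', hp.proj_smul, h]
    · rw [h2 _ he]; simp
  · rintro k rfl
    rw [h2 _ he]; simp

theorem IsRightPrincipalBundle.existsUnique_smul [MulAction Hᵐᵒᵖ E] {p : E → M}
    (hp : IsRightPrincipalBundle EH EM EE (H := H) p) {e e' : E} (h : p e' = p e) :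
    ∃! k : H, e <• k = e' := by
  obtain ⟨U, -, hxU, Φ, hs, -, -, -, h1, h2⟩ := hp.exists_trivialization (p e)
  have he : e ∈ Φ.source := by rw [hs]; exact hxU
  have he' : e' ∈ Φ.source := by rw [hs]; show p e' ∈ U; rw [h]; exact hxU
  have hk : ∀ k : H, e <• k ∈ Φ.source := fun k => by
    rw [hs]; show p (e <• k) ∈ U; rw [hp.proj_smul]; exact hxU
  refine ⟨(Φ e).2⁻¹ * (Φ e').2, ?_, ?_⟩
  · apply Φ.injOn (hk _) he'
    ext
    · rw [h1 _ (hk _), h1 _ he', hp.proj_smul, h]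
    · rw [h2 _ he]; simp
  · rintro k rfl
    rw [h2 _ he]; simp

variable [MulAction H E] [MulAction Hᵐᵒᵖ E] {p : E → M}

theorem IsPrincipalBibundle.existsUnique_left (hp : IsPrincipalBibundle EH EM EE H p)
    (e : E) (h : H) : ∃! k : H, k • e = e <• h :=
  hp.left.existsUnique_smul (hp.right.proj_smul e h)

theorem IsPrincipalBibundle.existsUnique_right (hp : IsPrincipalBibundle EH EM EE H p)
    (e : E) (k : H) : ∃! h : H, e <• h = k • e :=
  hp.right.existsUnique_smul (hp.left.proj_smul k e)

/-- The automorphism `φ_e` of `H` attached to `e ∈ E`, characterized by `φ_e(h) e = e ◁ h`. -/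
def phi (hp : IsPrincipalBibundle EH EM EE H p) (e : E) : H ≃* H where
  toFun h := (hp.existsUnique_left e h).choose
  invFun k := (hp.existsUnique_right e k).choose
  left_inv h := (hp.existsUnique_right e _).unique
    (hp.existsUnique_right e _).choose_spec.1 (hp.existsUnique_left e h).choose_spec.1.symm
  right_inv k := (hp.existsUnique_left e _).unique
    (hp.existsUnique_left e _).choose_spec.1 (hp.existsUnique_right e k).choose_spec.1.symm
  map_mul' h h' := (hp.existsUnique_left e _).unique
    (hp.existsUnique_left e _).choose_spec.1 (by
      have h1 := (hp.existsUnique_left e h).choose_spec.1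
      have h2 := (hp.existsUnique_left e h').choose_spec.1
      simp only at h1 h2 ⊢
      rw [mul_smul, h2, ← hp.smul_comm, h1, smul_smul, MulOpposite.op_mul])

theorem phi_smul (hp : IsPrincipalBibundle EH EM EE H p) (e : E) (h : H) :
    phi hp e h • e = e <• h :=
  (hp.existsUnique_left e h).choose_spec.1

end Bundles

/-! ### The Lie algebra of `H`, the group `Aut(H)` and its Lie algebra

`Lie(H)` is Mathlib's `GroupLieAlgebra`, the tangent space at `1`. Several differentials below take
values in a tangent space at a point that is equal to `1` (or to `h`), but not syntactically so;
all tangent spaces of `H` are by definition the model space `EH`, so that no cast is needed. -/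

section LieAlgebras

variable (EH : Type*) [NormedAddCommGroup EH] [NormedSpace ℝ EH]
  {H : Type*} [TopologicalSpace H] [ChartedSpace EH H] [Group H]

/-- The differential `f_* : Lie(H) → Lie(H)` at the identity of a map with `f 1 = 1`. -/
def diffOne (f : H → H) :
    GroupLieAlgebra 𝓘(ℝ, EH) H →L[ℝ] GroupLieAlgebra 𝓘(ℝ, EH) H :=
  (mfderiv 𝓘(ℝ, EH) 𝓘(ℝ, EH) f (1 : H) : EH →L[ℝ] EH)

/-- The adjoint action `Ad_h : Lie(H) → Lie(H)`. -/
def Ad (h : H) : GroupLieAlgebra 𝓘(ℝ, EH) H →L[ℝ] GroupLieAlgebra 𝓘(ℝ, EH) H :=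
  diffOne EH (fun k => h * k * h⁻¹)

/-- A smooth curve `t ↦ α t` in `Aut(H)`, the group of smooth automorphisms of `H`, with
`α 0 = 1`. -/
structure IsSmoothAutCurve (α : ℝ → H ≃* H) : Prop where
  zero : α 0 = MulEquiv.refl H
  contMDiff : ContMDiff (𝓘(ℝ, ℝ).prod 𝓘(ℝ, EH)) 𝓘(ℝ, EH) ∞ (fun q : ℝ × H => α q.1 q.2)
  contMDiff_symm :
    ContMDiff (𝓘(ℝ, ℝ).prod 𝓘(ℝ, EH)) 𝓘(ℝ, EH) ∞ (fun q : ℝ × H => (α q.1).symm q.2)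

/-- The velocity at `t = 0` of a curve in `Aut(H)` starting at the identity, as a vector field on
`H`: its value at `h` is the tangent vector `[α t (h)]`. -/
def velocity (α : ℝ → H ≃* H) : Π h : H, TangentSpace 𝓘(ℝ, EH) h :=
  fun h => (mfderiv 𝓘(ℝ, ℝ) 𝓘(ℝ, EH) (fun t : ℝ => α t h) (0 : ℝ) : ℝ →L[ℝ] EH) (1 : ℝ)

variable {EH}

theorem IsSmoothAutCurve.mdifferentiableAt {α : ℝ → H ≃* H} (hα : IsSmoothAutCurve EH α)
    (q : ℝ × H) :
    MDifferentiableAt (𝓘(ℝ, ℝ).prod 𝓘(ℝ, EH)) 𝓘(ℝ, EH) (fun q : ℝ × H => α q.1 q.2) q :=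
  (hα.contMDiff q).mdifferentiableAt (by simp)

theorem IsSmoothAutCurve.refl [LieGroup 𝓘(ℝ, EH) ∞ H] :
    IsSmoothAutCurve EH (fun _ : ℝ => MulEquiv.refl H) :=
  ⟨rfl, contMDiff_snd, contMDiff_snd⟩

theorem IsSmoothAutCurve.mul {α β : ℝ → H ≃* H}
    (hα : IsSmoothAutCurve EH α) (hβ : IsSmoothAutCurve EH β) :
    IsSmoothAutCurve EH (fun t => (β t).trans (α t)) := by
  refine ⟨?_, ?_, ?_⟩
  · rw [hα.zero, hβ.zero]; rfl
  · exact hα.contMDiff.comp (contMDiff_fst.prodMk hβ.contMDiff)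
  · exact hβ.contMDiff_symm.comp (contMDiff_fst.prodMk hα.contMDiff_symm)

theorem IsSmoothAutCurve.comp_mul {α : ℝ → H ≃* H} (hα : IsSmoothAutCurve EH α) (c : ℝ) :
    IsSmoothAutCurve EH (fun t => α (c * t)) := by
  have hc : ContMDiff 𝓘(ℝ, ℝ) 𝓘(ℝ, ℝ) ∞ (fun t : ℝ => c * t) :=
    (contDiff_const.mul contDiff_id).contMDiff
  refine ⟨?_, ?_, ?_⟩
  · rw [mul_zero, hα.zero]
  · exact hα.contMDiff.comp ((hc.comp contMDiff_fst).prodMk contMDiff_snd)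
  · exact hα.contMDiff_symm.comp ((hc.comp contMDiff_fst).prodMk contMDiff_snd)

theorem velocity_refl : velocity EH (fun _ : ℝ => MulEquiv.refl H) = 0 := by
  funext h
  show (mfderiv 𝓘(ℝ, ℝ) 𝓘(ℝ, EH) (fun _ : ℝ => h) (0 : ℝ) : ℝ →L[ℝ] EH) (1 : ℝ) = 0
  rw [mfderiv_const]; rfl

theorem velocity_mul {α β : ℝ → H ≃* H}
    (hα : IsSmoothAutCurve EH α) (hβ : IsSmoothAutCurve EH β) :
    velocity EH (fun t => (β t).trans (α t)) = velocity EH α + velocity EH β := by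
  funext h
  have hβ' : MDifferentiableAt 𝓘(ℝ, ℝ) 𝓘(ℝ, EH) (fun t : ℝ => β t h) 0 :=
    (hβ.mdifferentiableAt (0, h)).comp (0 : ℝ) (mdifferentiableAt_id.prodMk mdifferentiableAt_const)
  have hF := hα.mdifferentiableAt (0, β 0 h)
  have hG : MDifferentiableAt 𝓘(ℝ, ℝ) (𝓘(ℝ, ℝ).prod 𝓘(ℝ, EH)) (fun t : ℝ => (t, β t h)) 0 :=
    mdifferentiableAt_id.prodMk hβ'
  have h1 : mfderiv 𝓘(ℝ, ℝ) 𝓘(ℝ, EH) (fun t : ℝ => α t (β t h)) (0 : ℝ) =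
      (mfderiv (𝓘(ℝ, ℝ).prod 𝓘(ℝ, EH)) 𝓘(ℝ, EH) (fun q : ℝ × H => α q.1 q.2) (0, β 0 h)).comp
        (mfderiv 𝓘(ℝ, ℝ) (𝓘(ℝ, ℝ).prod 𝓘(ℝ, EH)) (fun t : ℝ => (t, β t h)) 0) :=
    mfderiv_comp (0 : ℝ) hF hG
  have h2 : mfderiv 𝓘(ℝ, ℝ) (𝓘(ℝ, ℝ).prod 𝓘(ℝ, EH)) (fun t : ℝ => (t, β t h)) 0 =
      (mfderiv 𝓘(ℝ, ℝ) 𝓘(ℝ, ℝ) (fun t : ℝ => t) 0).prod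
        (mfderiv 𝓘(ℝ, ℝ) 𝓘(ℝ, EH) (fun t : ℝ => β t h) 0) :=
    mdifferentiableAt_id.mfderiv_prod hβ'
  have h3 : (fun z : H => α 0 z) = id := by rw [hα.zero]; rfl
  have h4 : β 0 h = h := by rw [hβ.zero]; rfl
  have h5 : (mfderiv 𝓘(ℝ, ℝ) 𝓘(ℝ, ℝ) (fun t : ℝ => t) 0 : ℝ →L[ℝ] ℝ) 1 = 1 := by
    have : mfderiv 𝓘(ℝ, ℝ) 𝓘(ℝ, ℝ) (fun t : ℝ => t) 0 = ContinuousLinearMap.id ℝ _ := mfderiv_id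
    rw [this]; rfl
  have h6 : ∀ w : EH, (mfderiv 𝓘(ℝ, EH) 𝓘(ℝ, EH) (fun z : H => α 0 z) (β 0 h) : EH →L[ℝ] EH) w
      = w := by
    intro w
    rw [h3, mfderiv_id]; rfl
  have e1 : (velocity EH (fun t => (β t).trans (α t)) h : EH) =
      (mfderiv (𝓘(ℝ, ℝ).prod 𝓘(ℝ, EH)) 𝓘(ℝ, EH) (fun q : ℝ × H => α q.1 q.2) (0, β 0 h) :
          ℝ × EH →L[ℝ] EH)
          ((mfderiv 𝓘(ℝ, ℝ) 𝓘(ℝ, ℝ) (fun t : ℝ => t) 0 : ℝ →L[ℝ] ℝ) 1, velocity EH β h) := by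
    show (mfderiv 𝓘(ℝ, ℝ) 𝓘(ℝ, EH) (fun t : ℝ => α t (β t h)) (0 : ℝ) : ℝ →L[ℝ] EH) (1 : ℝ) = _
    rw [h1, h2]; rfl
  have e2 : ∀ (s : ℝ) (w : EH),
      (mfderiv (𝓘(ℝ, ℝ).prod 𝓘(ℝ, EH)) 𝓘(ℝ, EH) (fun q : ℝ × H => α q.1 q.2) (0, β 0 h) :
          ℝ × EH →L[ℝ] EH) (s, w) =
      (mfderiv 𝓘(ℝ, ℝ) 𝓘(ℝ, EH) (fun t : ℝ => α t (β 0 h)) 0 : ℝ →L[ℝ] EH) s +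
        (mfderiv 𝓘(ℝ, EH) 𝓘(ℝ, EH) (fun z : H => α 0 z) (β 0 h) : EH →L[ℝ] EH) w :=
    fun s w => mfderiv_prod_eq_add_apply (v := (s, w)) hF
  have e3 : (mfderiv 𝓘(ℝ, ℝ) 𝓘(ℝ, EH) (fun t : ℝ => α t (β 0 h)) 0 : ℝ →L[ℝ] EH) 1 =
      velocity EH α h := by
    rw [h4]; rfl
  have e4 : (mfderiv 𝓘(ℝ, ℝ) 𝓘(ℝ, EH) (fun t : ℝ => α t (β 0 h)) 0 : ℝ →L[ℝ] EH)
      ((mfderiv 𝓘(ℝ, ℝ) 𝓘(ℝ, ℝ) (fun t : ℝ => t) 0 : ℝ →L[ℝ] ℝ) 1) = velocity EH α h :=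
    (congrArg (mfderiv 𝓘(ℝ, ℝ) 𝓘(ℝ, EH) (fun t : ℝ => α t (β 0 h)) 0 : ℝ →L[ℝ] EH) h5).trans e3
  exact e1.trans ((e2 _ _).trans (congrArg₂ (fun x y : EH => x + y) e4 (h6 _)))

theorem velocity_comp_mul {α : ℝ → H ≃* H} (hα : IsSmoothAutCurve EH α) (c : ℝ) :
    velocity EH (fun t => α (c * t)) = c • velocity EH α := by
  funext h
  have hα' : MDifferentiableAt 𝓘(ℝ, ℝ) 𝓘(ℝ, EH) (fun t : ℝ => α t h) (c * 0) :=
    (hα.mdifferentiableAt (c * 0, h)).comp (c * 0 : ℝ)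
      (mdifferentiableAt_id.prodMk mdifferentiableAt_const)
  have hc : HasMFDerivAt 𝓘(ℝ, ℝ) 𝓘(ℝ, ℝ) (fun t : ℝ => c * t) 0
      (c • ContinuousLinearMap.id ℝ ℝ) :=
    ((hasFDerivAt_id (0 : ℝ)).const_mul c).hasMFDerivAt
  have h1 : mfderiv 𝓘(ℝ, ℝ) 𝓘(ℝ, EH) (fun t : ℝ => α (c * t) h) (0 : ℝ) =
      (mfderiv 𝓘(ℝ, ℝ) 𝓘(ℝ, EH) (fun t : ℝ => α t h) (c * 0)).comp
        (mfderiv 𝓘(ℝ, ℝ) 𝓘(ℝ, ℝ) (fun t : ℝ => c * t) 0) :=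
    mfderiv_comp (0 : ℝ) hα' hc.mdifferentiableAt
  show (mfderiv 𝓘(ℝ, ℝ) 𝓘(ℝ, EH) (fun t : ℝ => α (c * t) h) (0 : ℝ) : ℝ →L[ℝ] EH) (1 : ℝ) =
    c • (mfderiv 𝓘(ℝ, ℝ) 𝓘(ℝ, EH) (fun t : ℝ => α t h) (0 : ℝ) : ℝ →L[ℝ] EH) (1 : ℝ)
  rw [h1, hc.mfderiv, mul_zero]
  exact ContinuousLinearMap.map_smul
    (mfderiv 𝓘(ℝ, ℝ) 𝓘(ℝ, EH) (fun t : ℝ => α t h) (0 : ℝ) : ℝ →L[ℝ] EH) c (1 : ℝ)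

variable (EH H)

/-- `Lie(Aut(H))`: the tangent space at the identity of `Aut(H)`, i.e. the space of velocities at
the identity of smooth curves in `Aut(H)`. An element is recorded as the vector field on `H` by
which it acts infinitesimally on `H`; `X = [e^{tX}]` is the field `h ↦ [e^{tX}(h)]`. -/
def LieAut [LieGroup 𝓘(ℝ, EH) ∞ H] : Submodule ℝ (Π h : H, TangentSpace 𝓘(ℝ, EH) h) where
  carrier := {X | ∃ α : ℝ → H ≃* H, IsSmoothAutCurve EH α ∧ velocity EH α = X}
  zero_mem' := ⟨_, IsSmoothAutCurve.refl, velocity_refl⟩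
  add_mem' := by
    rintro _ _ ⟨α, hα, rfl⟩ ⟨β, hβ, rfl⟩
    exact ⟨_, hα.mul hβ, velocity_mul hα hβ⟩
  smul_mem' := by
    rintro c _ ⟨α, hα, rfl⟩
    exact ⟨_, hα.comp_mul c, velocity_comp_mul hα c⟩

variable {H}

/-- `T_X(h) = [h e^{tX}(h⁻¹)] ∈ Lie(H)`: the image of the tangent vector `[e^{tX}(h⁻¹)]` of `H` at
`h⁻¹` under the differential of left multiplication by `h`. -/
def T (X : Π h : H, TangentSpace 𝓘(ℝ, EH) h) (h : H) : GroupLieAlgebra 𝓘(ℝ, EH) H :=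
  (mfderiv 𝓘(ℝ, EH) 𝓘(ℝ, EH) (fun k => h * k) h⁻¹ : EH →L[ℝ] EH) (X h⁻¹)

/-- `ad_Y = [Ad_{g(t)}] ∈ Lie(Aut(H))`, for `Y = [g(t)] ∈ Lie(H)`: the vector field
`h ↦ [g(t) h g(t)⁻¹]`. -/
def ad (Y : GroupLieAlgebra 𝓘(ℝ, EH) H) : Π h : H, TangentSpace 𝓘(ℝ, EH) h :=
  fun h => (mfderiv 𝓘(ℝ, EH) 𝓘(ℝ, EH) (fun k => k * h * k⁻¹) (1 : H) : EH →L[ℝ] EH) Y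

/-- `f⁻¹ X f = [f⁻¹ ∘ α_t ∘ f]`, for `f ∈ Aut(H)` and `X = [α_t] ∈ Lie(Aut(H))`: the vector field
`h ↦ [f⁻¹(α_t(f(h)))]`. -/
def conj (f : H ≃* H) (X : Π h : H, TangentSpace 𝓘(ℝ, EH) h) :
    Π h : H, TangentSpace 𝓘(ℝ, EH) h :=
  fun h => (mfderiv 𝓘(ℝ, EH) 𝓘(ℝ, EH) f.symm (f h) : EH →L[ℝ] EH) (X (f h))

end LieAlgebras

/-! ### 2-connections -/

section Connections

variable (EH EM EE : Type*)
  [NormedAddCommGroup EH] [NormedSpace ℝ EH]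
  [NormedAddCommGroup EM] [NormedSpace ℝ EM]
  [NormedAddCommGroup EE] [NormedSpace ℝ EE]
  (H : Type*) {M E : Type*}
  [TopologicalSpace H] [ChartedSpace EH H] [Group H] [LieGroup 𝓘(ℝ, EH) ∞ H]
  [TopologicalSpace M] [ChartedSpace EM M] [IsManifold 𝓘(ℝ, EM) ∞ M]
  [TopologicalSpace E] [ChartedSpace EE E] [IsManifold 𝓘(ℝ, EE) ∞ E]

/-- `Lie(H)`-valued one-forms on `E` (smoothness is a separate predicate). -/
abbrev LieForm (E : Type*) [TopologicalSpace E] [ChartedSpace EE E] : Type _ :=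
  Π e : E, TangentSpace 𝓘(ℝ, EE) e →L[ℝ] GroupLieAlgebra 𝓘(ℝ, EH) H

/-- `Lie(Aut(H))`-valued one-forms on `M` (smoothness is a separate predicate). -/
abbrev LieAutForm (M : Type*) [TopologicalSpace M] [ChartedSpace EM M] : Type _ :=
  Π x : M, TangentSpace 𝓘(ℝ, EM) x →ₗ[ℝ] LieAut EH H

variable {EH EM EE H}

/-- Smoothness of a `Lie(H)`-valued one-form, as a map on the total space of the tangent bundle. -/
def LieForm.IsSmooth (a : LieForm EH EE H E) : Prop :=
  ContMDiff (M' := EH) 𝓘(ℝ, EE).tangent 𝓘(ℝ, EH) ∞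
    (fun v : TangentBundle 𝓘(ℝ, EE) E => (a v.proj v.snd : EH))

/-- Smoothness of a `Lie(Aut(H))`-valued one-form: the tangent vector `A(v)(h)` of `H` depends
smoothly on `(v, h)`. When `Lie(Aut(H))` has a finite basis `X^ρ` and `A = A^ρ X^ρ`, this says that
the one-forms `A^ρ` are smooth. -/
def LieAutForm.IsSmooth (A : LieAutForm EH EM H M) : Prop :=
  ContMDiff (𝓘(ℝ, EM).tangent.prod 𝓘(ℝ, EH)) 𝓘(ℝ, EH).tangent ∞
    (fun q : TangentBundle 𝓘(ℝ, EM) M × H =>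
      (⟨q.2, (A q.1.proj q.1.snd : Π h : H, TangentSpace 𝓘(ℝ, EH) h) q.2⟩ :
        TangentBundle 𝓘(ℝ, EH) H))

/-- The value of a `Lie(H)`-valued one-form on a tangent vector `v` of `E`. -/
def LieForm.eval (a : LieForm EH EE H E) (v : TangentBundle 𝓘(ℝ, EE) E) :
    GroupLieAlgebra 𝓘(ℝ, EH) H :=
  a v.proj v.snd

/-- The value of a `Lie(Aut(H))`-valued one-form on a tangent vector `v` of `M`. -/
def LieAutForm.eval (A : LieAutForm EH EM H M) (v : TangentBundle 𝓘(ℝ, EM) M) :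
    Π h : H, TangentSpace 𝓘(ℝ, EH) h :=
  (A v.proj v.snd : LieAut EH H)

/-- `(a, A)` is a (left) 2-connection on `p : E → M`. -/
structure IsTwoConnection [MulAction H E] (p : E → M)
    (a : LieForm EH EE H E) (A : LieAutForm EH EM H M) : Prop where
  smooth_a : a.IsSmooth
  smooth_A : A.IsSmooth
  /-- `a[g(t) e] = -[g(t)]`: on the fibres `a` is the right-invariant Maurer-Cartan form. -/
  maurerCartan : ∀ (e : E) (Y : GroupLieAlgebra 𝓘(ℝ, EH) H),
    a.eval (tangentMap 𝓘(ℝ, EH) 𝓘(ℝ, EE) (fun h : H => h • e) ⟨1, Y⟩) = -Y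
  /-- `l^{h*} a = Ad_h a + p^* T_A(h)`. -/
  equivariance : ∀ (h : H) (v : TangentBundle 𝓘(ℝ, EE) E),
    a.eval (tangentMap 𝓘(ℝ, EE) 𝓘(ℝ, EE) (fun e : E => h • e) v) =
      Ad EH h (a.eval v) + T EH (A.eval (tangentMap 𝓘(ℝ, EE) 𝓘(ℝ, EM) p v)) h

/-- `(a, A)` is a right 2-connection on `p : E → M`. -/
structure IsRightTwoConnection [MulAction Hᵐᵒᵖ E] (p : E → M)
    (a : LieForm EH EE H E) (A : LieAutForm EH EM H M) : Prop where
  smooth_a : a.IsSmooth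
  smooth_A : A.IsSmooth
  /-- `a[e g(t)] = [g(t)]`: on the fibres `a` is the left-invariant Maurer-Cartan form. -/
  maurerCartan : ∀ (e : E) (Y : GroupLieAlgebra 𝓘(ℝ, EH) H),
    a.eval (tangentMap 𝓘(ℝ, EH) 𝓘(ℝ, EE) (fun h : H => e <• h) ⟨1, Y⟩) = Y
  /-- `r^{h*} a = Ad_{h⁻¹} a + p^* T_A(h⁻¹)`. -/
  equivariance : ∀ (h : H) (v : TangentBundle 𝓘(ℝ, EE) E),
    a.eval (tangentMap 𝓘(ℝ, EE) 𝓘(ℝ, EE) (fun e : E => e <• h) v) =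
      Ad EH h⁻¹ (a.eval v) + T EH (A.eval (tangentMap 𝓘(ℝ, EE) 𝓘(ℝ, EM) p v)) h⁻¹

variable [MulAction H E] [MulAction Hᵐᵒᵖ E] {p : E → M}

/-- `aʳ = -φ⁻¹(a)`, where `φ_e⁻¹` acts on `Lie(H)` by its differential at the identity. -/
def rightForm (hp : IsPrincipalBibundle EH EM EE H p) (a : LieForm EH EE H E) :
    LieForm EH EE H E :=
  fun e => -((diffOne EH (phi hp e).symm).comp (a e))

/-- `φ⁻¹ dφ` evaluated on a tangent vector `v = [γ(t)]` of `E` at `e`: the vector field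
`h ↦ [φ_e⁻¹(φ_{γ(t)}(h))]` on `H`. -/
def phiInvDPhi (hp : IsPrincipalBibundle EH EM EE H p) (v : TangentBundle 𝓘(ℝ, EE) E) :
    Π h : H, TangentSpace 𝓘(ℝ, EH) h :=
  fun h => (mfderiv 𝓘(ℝ, EE) 𝓘(ℝ, EH)
    (fun e : E => (phi hp v.proj).symm (phi hp e h)) v.proj : EE →L[ℝ] EH) v.snd

/-- `φ⁻¹ (p^*A + ad_a) φ + φ⁻¹ dφ`, evaluated on a tangent vector `v` of `E`. -/
def transformedForm (hp : IsPrincipalBibundle EH EM EE H p)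
    (a : LieForm EH EE H E) (A : LieAutForm EH EM H M) (v : TangentBundle 𝓘(ℝ, EE) E) :
    Π h : H, TangentSpace 𝓘(ℝ, EH) h :=
  conj EH (phi hp v.proj)
      (A.eval (tangentMap 𝓘(ℝ, EE) 𝓘(ℝ, EM) p v) + ad EH (a.eval v)) +
    phiInvDPhi hp v

end Connections

end Bibundle

end

noncomputable section

namespace Bibundle

/-! ### Velocities of curves -/

/-! Every tangent vector is the velocity of a smooth curve, so the identities between forms are
reduced to algebraic identities between curves in `H` and in `Aut(H)`. Let `γ` be a curve in `E`,
and let `g` and `α` be curves through the identity whose velocities are the values of `a` and `p^*A`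
on `[γ(t)]` (`Represents`). The transformed form on `[γ(t)]` is then the velocity of `φ_{γ(0)}⁻¹ ∘
Ad_{g(t)} ∘ α_t ∘ φ_{γ(t)}`.

The crux is what happens when `γ` is replaced by `k(t) γ(t)`. The two axioms of a 2-connection
together say that `g` may be replaced by `k(0) g(t) α_t(k(t)⁻¹)`, with `α` unchanged
(`Represents.smul`). Since `φ_{ke} = Ad_k ∘ φ_e`, the curve in `Aut(H)` does not change at all
(`transformedForm_smul`). In a left trivialization any two curves with the same projection differ by
such a `k`, so the transformed form depends only on the projection of the vector. It descends to `M`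
through local sections (`exists_section`), which gives existence, uniqueness and smoothness of `Aʳ`.

Right translation by `h` is the case `k(t) = φ_{γ(t)}(h)`, because `e ◁ h = φ_e(h) e`. The right
equivariance is then one identity in `H`, differentiated at `t = 0` (`rightForm_equivariance`). -/

theorem _root_.ContMDiff.mdiffAt {EN EP : Type*} [NormedAddCommGroup EN] [NormedSpace ℝ EN]
    [NormedAddCommGroup EP] [NormedSpace ℝ EP] {N P HN HP : Type*} [TopologicalSpace HN]
    [TopologicalSpace HP] {I : ModelWithCorners ℝ EN HN} {J : ModelWithCorners ℝ EP HP}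
    [TopologicalSpace N] [ChartedSpace HN N] [TopologicalSpace P] [ChartedSpace HP P]
    {f : N → P} (hf : ContMDiff I J ∞ f) {x : N} : MDifferentiableAt I J f x :=
  hf.contMDiffAt.mdifferentiableAt (by simp)

section Velocities

variable (EN : Type*) [NormedAddCommGroup EN] [NormedSpace ℝ EN]
  {N : Type*} [TopologicalSpace N] [ChartedSpace EN N]

/-- The velocity at `t = 0` of a curve in a manifold, as a vector of the model space. -/
def vel (c : ℝ → N) : EN :=
  (mfderiv 𝓘(ℝ, ℝ) 𝓘(ℝ, EN) c (0 : ℝ) : ℝ →L[ℝ] EN) (1 : ℝ)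

/-- The velocity at `t = 0` of a curve in a manifold, as an element of the tangent bundle. -/
def tvec (c : ℝ → N) : TangentBundle 𝓘(ℝ, EN) N := ⟨c 0, vel EN c⟩

variable {EN}

theorem tvec_eq {c : ℝ → N} {x : N} (h : c 0 = x) :
    tvec EN c = (⟨x, vel EN c⟩ : TangentBundle 𝓘(ℝ, EN) N) := by
  subst h; rfl

theorem vel_const (x : N) : vel EN (fun _ : ℝ => x) = 0 := by
  unfold vel
  rw [mfderiv_const]; rfl

variable {EP : Type*} [NormedAddCommGroup EP] [NormedSpace ℝ EP]
  {P : Type*} [TopologicalSpace P] [ChartedSpace EP P]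

theorem vel_comp {f : N → P} {c : ℝ → N} (hf : MDifferentiableAt 𝓘(ℝ, EN) 𝓘(ℝ, EP) f (c 0))
    (hc : MDifferentiableAt 𝓘(ℝ, ℝ) 𝓘(ℝ, EN) c 0) :
    vel EP (fun t => f (c t)) =
      (mfderiv 𝓘(ℝ, EN) 𝓘(ℝ, EP) f (c 0) : EN →L[ℝ] EP) (vel EN c) := by
  unfold vel
  have := mfderiv_comp (0 : ℝ) hf hc
  exact congrArg (fun L : ℝ →L[ℝ] EP => L 1) this

/-- The base point is a free `x` because the curves used later start at points such as `1` or `f h`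
only up to a provable equality. -/
theorem vel_comp_of_eq {f : N → P} {c : ℝ → N} {x : N} (h : c 0 = x)
    (hf : MDifferentiableAt 𝓘(ℝ, EN) 𝓘(ℝ, EP) f x)
    (hc : MDifferentiableAt 𝓘(ℝ, ℝ) 𝓘(ℝ, EN) c 0) :
    (mfderiv 𝓘(ℝ, EN) 𝓘(ℝ, EP) f x : EN →L[ℝ] EP) (vel EN c) = vel EP (fun t => f (c t)) := by
  subst h
  exact (vel_comp hf hc).symm

theorem tangentMap_tvec {f : N → P} {c : ℝ → N}
    (hf : MDifferentiableAt 𝓘(ℝ, EN) 𝓘(ℝ, EP) f (c 0))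
    (hc : MDifferentiableAt 𝓘(ℝ, ℝ) 𝓘(ℝ, EN) c 0) :
    tangentMap 𝓘(ℝ, EN) 𝓘(ℝ, EP) f (tvec EN c) = tvec EP (fun t => f (c t)) :=
  congrArg (fun w : EP => (⟨f (c 0), w⟩ : TangentBundle 𝓘(ℝ, EP) P)) (vel_comp hf hc).symm

variable {EQ : Type*} [NormedAddCommGroup EQ] [NormedSpace ℝ EQ]
  {Q : Type*} [TopologicalSpace Q] [ChartedSpace EQ Q]

/-- The total derivative is the sum of the partial ones. This is the product rule used for
multiplication in `H`, for the action `k(t) γ(t)` and for `α_t(k(t)⁻¹)`. -/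
theorem vel_comp₂ {F : N × P → Q} {c : ℝ → N} {d : ℝ → P}
    (hF : MDifferentiableAt (𝓘(ℝ, EN).prod 𝓘(ℝ, EP)) 𝓘(ℝ, EQ) F (c 0, d 0))
    (hc : MDifferentiableAt 𝓘(ℝ, ℝ) 𝓘(ℝ, EN) c 0)
    (hd : MDifferentiableAt 𝓘(ℝ, ℝ) 𝓘(ℝ, EP) d 0) :
    vel EQ (fun t => F (c t, d t)) =
      vel EQ (fun t => F (c t, d 0)) + vel EQ (fun t => F (c 0, d t)) := by
  have h1 : mfderiv 𝓘(ℝ, ℝ) 𝓘(ℝ, EQ) (fun t : ℝ => F (c t, d t)) (0 : ℝ) =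
      (mfderiv (𝓘(ℝ, EN).prod 𝓘(ℝ, EP)) 𝓘(ℝ, EQ) F (c 0, d 0)).comp
        (mfderiv 𝓘(ℝ, ℝ) (𝓘(ℝ, EN).prod 𝓘(ℝ, EP)) (fun t : ℝ => (c t, d t)) 0) :=
    mfderiv_comp (0 : ℝ) hF (hc.prodMk hd)
  have h2 := hc.mfderiv_prod hd
  have e1 : vel EQ (fun t => F (c t, d t)) =
      (mfderiv (𝓘(ℝ, EN).prod 𝓘(ℝ, EP)) 𝓘(ℝ, EQ) F (c 0, d 0) : EN × EP →L[ℝ] EQ)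
        (vel EN c, vel EP d) := by
    unfold vel
    rw [h1, h2]; rfl
  have e2 : (mfderiv (𝓘(ℝ, EN).prod 𝓘(ℝ, EP)) 𝓘(ℝ, EQ) F (c 0, d 0) : EN × EP →L[ℝ] EQ)
        (vel EN c, vel EP d) =
      (mfderiv 𝓘(ℝ, EN) 𝓘(ℝ, EQ) (fun x => F (x, d 0)) (c 0) : EN →L[ℝ] EQ) (vel EN c) +
      (mfderiv 𝓘(ℝ, EP) 𝓘(ℝ, EQ) (fun y => F (c 0, y)) (d 0) : EP →L[ℝ] EQ) (vel EP d) :=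
    mfderiv_prod_eq_add_apply (v := (vel EN c, vel EP d)) hF
  have h3 : MDifferentiableAt 𝓘(ℝ, EN) 𝓘(ℝ, EQ) (fun x => F (x, d 0)) (c 0) :=
    MDifferentiableAt.comp (c 0) (g := F) (f := fun x => (x, d 0)) hF
      (mdifferentiableAt_id.prodMk mdifferentiableAt_const)
  have h4 : MDifferentiableAt 𝓘(ℝ, EP) 𝓘(ℝ, EQ) (fun y => F (c 0, y)) (d 0) :=
    MDifferentiableAt.comp (d 0) (g := F) (f := fun y => (c 0, y)) hF
      (mdifferentiableAt_const.prodMk mdifferentiableAt_id)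
  exact e1.trans (e2.trans
    (congrArg₂ (fun x y : EQ => x + y) (vel_comp h3 hc).symm (vel_comp h4 hd).symm))

/-- Every tangent vector is the velocity of a globally defined smooth curve, which can be chosen
inside a given neighbourhood of the base point. -/
theorem exists_curve [IsManifold 𝓘(ℝ, EN) ∞ N] (v : TangentBundle 𝓘(ℝ, EN) N)
    {U : Set N} (hU : U ∈ nhds v.proj) :
    ∃ c : ℝ → N, ContMDiff 𝓘(ℝ, ℝ) 𝓘(ℝ, EN) ∞ c ∧ (∀ t, c t ∈ U) ∧ tvec EN c = v := by
  obtain ⟨x, v⟩ := v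
  change U ∈ nhds x at hU
  let χ := extChartAt 𝓘(ℝ, EN) x
  have hsm : ContMDiffOn 𝓘(ℝ, EN) 𝓘(ℝ, EN) ∞ χ.symm χ.target := contMDiffOn_extChartAt_symm x
  have hx : χ.symm (χ x) = x := extChartAt_to_inv x
  -- The tangent space at `x` is identified with the model space by the preferred chart at `x`, so
  -- in it this chart has identity derivative.
  have hw : (mfderiv 𝓘(ℝ, EN) 𝓘(ℝ, EN) χ.symm (χ x) : EN →L[ℝ] EN) =
      ContinuousLinearMap.id ℝ EN := by
    have h := mfderivWithin_range_extChartAt_symm (I := 𝓘(ℝ, EN)) (x := x)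
    rw [ModelWithCorners.range_eq_univ, mfderivWithin_univ] at h
    exact h
  let w : EN := v
  have hopen : IsOpen χ.target := isOpen_extChartAt_target x
  have hcont : ContinuousAt χ.symm (χ x) := continuousAt_extChartAt_symm x
  have hnhds : χ.target ∩ χ.symm ⁻¹' U ∈ nhds (χ x) :=
    Filter.inter_mem (hopen.mem_nhds (mem_extChartAt_target x))
      (hcont.preimage_mem_nhds (by rw [hx]; exact hU))
  obtain ⟨ε, hε, hball⟩ := Metric.mem_nhds_iff.1 hnhds
  -- The curve `χ x + δ sin(t/δ) w` has velocity `w` at `0` and stays within `δ ‖w‖ ≤ ε / 2` of `χ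
  -- x` for all `t`. The `+ 1` covers `w = 0`.
  let δ : ℝ := ε / (2 * (‖w‖ + 1))
  have hw1 : 0 < ‖w‖ + 1 := by positivity
  have hδ : 0 < δ := by positivity
  let s : ℝ → EN := fun t => χ x + (δ * Real.sin (t / δ)) • w
  have hs : ∀ t, s t ∈ χ.target ∩ χ.symm ⁻¹' U := by
    intro t
    apply hball
    rw [Metric.mem_ball, dist_eq_norm]
    have h1 : s t - χ x = (δ * Real.sin (t / δ)) • w := by simp [s]
    rw [h1, norm_smul, Real.norm_eq_abs, abs_mul, abs_of_pos hδ]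
    have h2 : |Real.sin (t / δ)| ≤ 1 := Real.abs_sin_le_one _
    calc δ * |Real.sin (t / δ)| * ‖w‖ ≤ δ * 1 * (‖w‖ + 1) := by gcongr; linarith
      _ = ε / 2 := by simp only [δ]; field_simp
      _ < ε := by linarith
  have hsd : ContDiff ℝ ∞ s :=
    contDiff_const.add ((contDiff_const.mul
      (Real.contDiff_sin.comp (contDiff_id.div_const δ))).smul contDiff_const)
  have hs0 : s 0 = χ x := by simp [s]
  have hder : HasDerivAt s w 0 := by
    have h1 : HasDerivAt (fun t : ℝ => t / δ) (1 / δ) 0 := (hasDerivAt_id 0).div_const δ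
    have h2 : HasDerivAt (fun t : ℝ => δ * Real.sin (t / δ)) 1 0 := by
      have h := (h1.sin).const_mul δ
      have h' : δ * (Real.cos (0 / δ) * (1 / δ)) = 1 := by
        rw [zero_div, Real.cos_zero]; field_simp
      rwa [h'] at h
    have h3 := (h2.smul_const w).const_add (χ x)
    simpa [s] using h3
  have hvs : vel EN s = w := by
    unfold vel
    rw [mfderiv_eq_fderiv]
    exact hder.deriv
  refine ⟨fun t => χ.symm (s t), ?_, fun t => (hs t).2, ?_⟩
  · exact fun t => (hsm.contMDiffAt (hopen.mem_nhds (hs t).1)).comp t hsd.contMDiff.contMDiffAt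
  · have hm : MDifferentiableAt 𝓘(ℝ, EN) 𝓘(ℝ, EN) χ.symm (χ x) :=
      (hsm.contMDiffAt (hopen.mem_nhds (mem_extChartAt_target x))).mdifferentiableAt (by simp)
    rw [tvec_eq (x := x) (by rw [hs0, hx])]
    have := vel_comp_of_eq hs0 hm (hsd.contMDiff.contMDiffAt.mdifferentiableAt (by simp))
    rw [hvs] at this
    exact congrArg (fun w : EN => (⟨x, w⟩ : TangentBundle 𝓘(ℝ, EN) N)) 
      (this.symm.trans (congrArg (fun L : EN →L[ℝ] EN => L w) hw))

end Velocities

section LieGroup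

variable {EH : Type*} [NormedAddCommGroup EH] [NormedSpace ℝ EH]
  {H : Type*} [TopologicalSpace H] [ChartedSpace EH H] [Group H] [LieGroup 𝓘(ℝ, EH) ∞ H]

theorem vel_mul {c d : ℝ → H} (hc : MDifferentiableAt 𝓘(ℝ, ℝ) 𝓘(ℝ, EH) c 0)
    (hd : MDifferentiableAt 𝓘(ℝ, ℝ) 𝓘(ℝ, EH) d 0) (hc0 : c 0 = 1) (hd0 : d 0 = 1) :
    vel EH (fun t => c t * d t) = vel EH c + vel EH d := by
  have h := vel_comp₂ (F := fun q : H × H => q.1 * q.2)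
    ((contMDiff_mul 𝓘(ℝ, EH) ∞).contMDiffAt.mdifferentiableAt (by simp)) hc hd
  simpa [hc0, hd0] using h

end LieGroup

/-! ### The automorphisms `φ_e` -/

section Phi

variable {EH EM EE : Type*}
  [NormedAddCommGroup EH] [NormedSpace ℝ EH]
  [NormedAddCommGroup EM] [NormedSpace ℝ EM]
  [NormedAddCommGroup EE] [NormedSpace ℝ EE]
  {H M E : Type*}
  [TopologicalSpace H] [ChartedSpace EH H] [Group H]
  [TopologicalSpace M] [ChartedSpace EM M]
  [TopologicalSpace E] [ChartedSpace EE E]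
  [MulAction H E] [MulAction Hᵐᵒᵖ E] {p : E → M}

theorem IsPrincipalBibundle.smul_left_cancel (hp : IsPrincipalBibundle EH EM EE H p) {e : E}
    {k k' : H} (h : k • e = k' • e) : k = k' :=
  (hp.left.existsUnique_smul (hp.left.proj_smul k' e)).unique h rfl

theorem smul_phi_symm (hp : IsPrincipalBibundle EH EM EE H p) (e : E) (k : H) :
    e <• (phi hp e).symm k = k • e := by
  rw [← phi_smul hp, MulEquiv.apply_symm_apply]

/-- The actions commute, so both sides move `k • e` to `k • (e <• h)`. Within a fibre, `φ_e` changes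
only by inner automorphisms. -/
theorem phi_smul_apply (hp : IsPrincipalBibundle EH EM EE H p) (k : H) (e : E) (h : H) :
    phi hp (k • e) h = k * phi hp e h * k⁻¹ := by
  apply hp.smul_left_cancel (e := k • e)
  rw [phi_smul, hp.smul_comm, ← phi_smul hp, smul_smul, smul_smul, inv_mul_cancel_right]

theorem phi_smul_symm_apply (hp : IsPrincipalBibundle EH EM EE H p) (k : H) (e : E) (h : H) :
    (phi hp (k • e)).symm h = (phi hp e).symm (k⁻¹ * h * k) := by
  rw [MulEquiv.symm_apply_eq, phi_smul_apply, MulEquiv.apply_symm_apply]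
  group


variable [LieGroup 𝓘(ℝ, EH) ∞ H]

/-- If `Φ₂` is the group coordinate of a left trivialization, then `Φ₂(e ◁ h) = φ_e(h) Φ₂(e)`, which
can be solved for `φ_e(h)`. -/
theorem contMDiff_phi (hp : IsPrincipalBibundle EH EM EE H p) :
    ContMDiff (𝓘(ℝ, EE).prod 𝓘(ℝ, EH)) 𝓘(ℝ, EH) ∞ (fun q : E × H => phi hp q.1 q.2) := by
  rintro ⟨e, h⟩
  obtain ⟨U, hU, hxU, Φ, hs, -, hΦ, -, h1, h2⟩ := hp.left.exists_trivialization (p e)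
  have hΦ2 : ∀ e' : E, p e' ∈ U →
      ContMDiffAt 𝓘(ℝ, EE) 𝓘(ℝ, EH) ∞ (fun y => (Φ y).2) e' := fun e' he' =>
    contMDiffAt_snd.comp e' (hΦ.contMDiffAt (Φ.open_source.mem_nhds (by rw [hs]; exact he')))
  have hr : ContMDiffAt (𝓘(ℝ, EE).prod 𝓘(ℝ, EH)) 𝓘(ℝ, EH) ∞
      (fun q : E × H => (Φ (q.1 <• q.2)).2 * (Φ q.1).2⁻¹) (e, h) := by
    refine ContMDiffAt.mul ?_ (ContMDiffAt.inv ?_)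
    · exact (hΦ2 (e <• h) (by rw [hp.right.proj_smul]; exact hxU)).comp (e, h)
        (f := fun q : E × H => q.1 <• q.2) (hp.right.contMDiff_smul (e, h))
    · exact (hΦ2 e hxU).comp (e, h) (f := Prod.fst) contMDiffAt_fst
  refine hr.congr_of_eventuallyEq ?_
  have hcont : ContinuousAt (fun q : E × H => q.1) (e, h) := continuousAt_fst
  filter_upwards [hcont.preimage_mem_nhds
    (Φ.open_source.mem_nhds (show e ∈ Φ.source by rw [hs]; exact hxU))] with q hq
  rw [← phi_smul hp, h2 _ hq, mul_inv_cancel_right]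

/-- The roles of left and right are exchanged: `e ◁ φ_e⁻¹(k) = k e` is read in a right
trivialization, so no inverse function theorem is needed. -/
theorem contMDiff_phi_symm (hp : IsPrincipalBibundle EH EM EE H p) :
    ContMDiff (𝓘(ℝ, EE).prod 𝓘(ℝ, EH)) 𝓘(ℝ, EH) ∞
      (fun q : E × H => (phi hp q.1).symm q.2) := by
  rintro ⟨e, h⟩
  obtain ⟨U, hU, hxU, Φ, hs, -, hΦ, -, h1, h2⟩ := hp.right.exists_trivialization (p e)
  have hΦ2 : ∀ e' : E, p e' ∈ U →
      ContMDiffAt 𝓘(ℝ, EE) 𝓘(ℝ, EH) ∞ (fun y => (Φ y).2) e' := fun e' he' =>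
    contMDiffAt_snd.comp e' (hΦ.contMDiffAt (Φ.open_source.mem_nhds (by rw [hs]; exact he')))
  have hr : ContMDiffAt (𝓘(ℝ, EE).prod 𝓘(ℝ, EH)) 𝓘(ℝ, EH) ∞
      (fun q : E × H => (Φ q.1).2⁻¹ * (Φ (q.2 • q.1)).2) (e, h) := by
    refine ContMDiffAt.mul (ContMDiffAt.inv ?_) ?_
    · exact (hΦ2 e hxU).comp (e, h) (f := Prod.fst) contMDiffAt_fst
    · exact (hΦ2 (h • e) (by rw [hp.left.proj_smul]; exact hxU)).comp (e, h)
        (f := fun q : E × H => q.2 • q.1)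
        ((hp.left.contMDiff_smul.comp (contMDiff_snd.prodMk contMDiff_fst)) (e, h))
  refine hr.congr_of_eventuallyEq ?_
  have hcont : ContinuousAt (fun q : E × H => q.1) (e, h) := continuousAt_fst
  filter_upwards [hcont.preimage_mem_nhds
    (Φ.open_source.mem_nhds (show e ∈ Φ.source by rw [hs]; exact hxU))] with q hq
  rw [← smul_phi_symm hp, h2 _ hq, inv_mul_cancel_left]

end Phi

/-! ### Curves in `Aut(H)` -/

section Curves

variable {EH : Type*} [NormedAddCommGroup EH] [NormedSpace ℝ EH]
  {H : Type*} [TopologicalSpace H] [ChartedSpace EH H] [Group H]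

/-- The curve `f⁻¹ ∘ α_t ∘ f`. -/
theorem IsSmoothAutCurve.conj {α : ℝ → H ≃* H} (hα : IsSmoothAutCurve EH α) {f : H ≃* H}
    (hf : ContMDiff 𝓘(ℝ, EH) 𝓘(ℝ, EH) ∞ f) (hf' : ContMDiff 𝓘(ℝ, EH) 𝓘(ℝ, EH) ∞ f.symm) :
    IsSmoothAutCurve EH (fun t => (f.trans (α t)).trans f.symm) := by
  refine ⟨?_, ?_, ?_⟩
  · rw [hα.zero]; ext h; simp
  · exact hf'.comp (hα.contMDiff.comp (contMDiff_fst.prodMk (hf.comp contMDiff_snd)))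
  · exact hf'.comp (hα.contMDiff_symm.comp (contMDiff_fst.prodMk (hf.comp contMDiff_snd)))

theorem IsSmoothAutCurve.contMDiff_apply {α : ℝ → H ≃* H} (hα : IsSmoothAutCurve EH α) (h : H) :
    ContMDiff 𝓘(ℝ, ℝ) 𝓘(ℝ, EH) ∞ (fun t => α t h) :=
  hα.contMDiff.comp (contMDiff_id.prodMk contMDiff_const)

theorem velocity_conj {α : ℝ → H ≃* H} (hα : IsSmoothAutCurve EH α) {f : H ≃* H}
    (hf' : ContMDiff 𝓘(ℝ, EH) 𝓘(ℝ, EH) ∞ f.symm) :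
    velocity EH (fun t => (f.trans (α t)).trans f.symm) = conj EH f (velocity EH α) := by
  funext h
  refine (vel_comp_of_eq (f := f.symm) (c := fun t => α t (f h)) ?_ ?_ ?_).symm
  · simp [hα.zero]
  · exact hf'.contMDiffAt.mdifferentiableAt (by simp)
  · exact (hα.contMDiff_apply _).contMDiffAt.mdifferentiableAt (by simp)

theorem diffOne_vel {f : H → H} {c : ℝ → H} (hc0 : c 0 = 1)
    (hf : ContMDiff 𝓘(ℝ, EH) 𝓘(ℝ, EH) ∞ f) (hc : ContMDiff 𝓘(ℝ, ℝ) 𝓘(ℝ, EH) ∞ c) :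
    diffOne EH f (vel EH c) = vel EH (fun t => f (c t)) :=
  vel_comp_of_eq hc0 hf.mdiffAt hc.mdiffAt

variable [LieGroup 𝓘(ℝ, EH) ∞ H]

/-- `Ad` along a curve in `H`. -/
theorem IsSmoothAutCurve.ofCurve {g : ℝ → H} (hg : ContMDiff 𝓘(ℝ, ℝ) 𝓘(ℝ, EH) ∞ g)
    (hg0 : g 0 = 1) : IsSmoothAutCurve EH (fun t => MulAut.conj (g t)) := by
  have hg' : ContMDiff (𝓘(ℝ, ℝ).prod 𝓘(ℝ, EH)) 𝓘(ℝ, EH) ∞ (fun q : ℝ × H => g q.1) :=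
    hg.comp contMDiff_fst
  refine ⟨?_, ?_, ?_⟩
  · rw [hg0, map_one]; rfl
  · exact (hg'.mul contMDiff_snd).mul hg'.inv
  · exact (hg'.inv.mul contMDiff_snd).mul hg'

theorem velocity_ofCurve {g : ℝ → H} (hg : ContMDiff 𝓘(ℝ, ℝ) 𝓘(ℝ, EH) ∞ g)
    (hg0 : g 0 = 1) : velocity EH (fun t => MulAut.conj (g t)) = ad EH (vel EH g) := by
  funext h
  refine (vel_comp_of_eq (f := fun k : H => k * h * k⁻¹) hg0 ?_
    (hg.contMDiffAt.mdifferentiableAt (by simp))).symm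
  have : ContMDiff 𝓘(ℝ, EH) 𝓘(ℝ, EH) ∞ (fun k : H => k * h * k⁻¹) :=
    (contMDiff_id.mul contMDiff_const).mul contMDiff_id.inv
  exact this.contMDiffAt.mdifferentiableAt (by simp)

theorem Ad_vel {c : ℝ → H} (hc0 : c 0 = 1) (hc : ContMDiff 𝓘(ℝ, ℝ) 𝓘(ℝ, EH) ∞ c) (h : H) :
    Ad EH h (vel EH c) = vel EH (fun t => h * c t * h⁻¹) :=
  diffOne_vel (f := fun k => h * k * h⁻¹) hc0
    ((contMDiff_const.mul contMDiff_id).mul contMDiff_const) hc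

theorem T_velocity {α : ℝ → H ≃* H} (hα : IsSmoothAutCurve EH α) (h : H) :
    T EH (velocity EH α) h = vel EH (fun t => h * α t h⁻¹) := by
  refine vel_comp_of_eq (f := fun k : H => h * k) (c := fun t => α t h⁻¹) ?_
    (ContMDiff.mdiffAt (contMDiff_const.mul contMDiff_id)) (hα.contMDiff_apply _).mdiffAt
  rw [hα.zero]; rfl

/-- The product of the two curves is constant, so their velocities sum to zero. -/
theorem vel_inv {c : ℝ → H} (hc0 : c 0 = 1) (hc : ContMDiff 𝓘(ℝ, ℝ) 𝓘(ℝ, EH) ∞ c) :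
    vel EH (fun t => (c t)⁻¹) = -vel EH c := by
  refine eq_neg_of_add_eq_zero_left ?_
  rw [← vel_mul (c := fun t => (c t)⁻¹) hc.inv.mdiffAt hc.mdiffAt (by simp [hc0]) hc0]
  simp [vel_const]

end Curves

/-! ### The transformed form along curves -/

section Transformed

variable {EH EM EE : Type*}
  [NormedAddCommGroup EH] [NormedSpace ℝ EH]
  [NormedAddCommGroup EM] [NormedSpace ℝ EM]
  [NormedAddCommGroup EE] [NormedSpace ℝ EE]
  {H M E : Type*}
  [TopologicalSpace H] [ChartedSpace EH H] [Group H]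
  [TopologicalSpace M] [ChartedSpace EM M]
  [TopologicalSpace E] [ChartedSpace EE E]
  {p : E → M}

section

variable [LieGroup 𝓘(ℝ, EH) ∞ H]

/-- `(g, α)` is a pair of smooth curves representing the values of `(a, A)` on `[γ(t)]`. -/
structure Represents (p : E → M) (a : LieForm EH EE H E) (A : LieAutForm EH EM H M)
    (γ : ℝ → E) (g : ℝ → H) (α : ℝ → H ≃* H) : Prop where
  contMDiff : ContMDiff 𝓘(ℝ, ℝ) 𝓘(ℝ, EH) ∞ g
  zero : g 0 = 1
  isSmoothAutCurve : IsSmoothAutCurve EH α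
  vel_eq : vel EH g = a.eval (tvec EE γ)
  velocity_eq : velocity EH α = A.eval (tangentMap 𝓘(ℝ, EE) 𝓘(ℝ, EM) p (tvec EE γ))

theorem exists_represents (p : E → M) (a : LieForm EH EE H E) (A : LieAutForm EH EM H M)
    (γ : ℝ → E) : ∃ g α, Represents p a A γ g α := by
  have : IsManifold 𝓘(ℝ, EH) ∞ H := inferInstance
  obtain ⟨g, hg, -, h⟩ := exists_curve
    (⟨1, a.eval (tvec EE γ)⟩ : TangentBundle 𝓘(ℝ, EH) H) Filter.univ_mem
  obtain ⟨α, hα, h'⟩ := (A _ (tangentMap 𝓘(ℝ, EE) 𝓘(ℝ, EM) p (tvec EE γ)).snd).2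
  exact ⟨g, α, hg, congrArg (fun v : TangentBundle 𝓘(ℝ, EH) H => v.proj) h, hα,
    congrArg (fun v : TangentBundle 𝓘(ℝ, EH) H => (v.snd : EH)) h, h'⟩

end

variable [MulAction H E] [MulAction Hᵐᵒᵖ E]

/-- The curve `t ↦ φ_{γ(0)}⁻¹ ∘ Ad_{g(t)} ∘ α_t ∘ φ_{γ(t)}` in `Aut(H)`. -/
def transformedCurve (hp : IsPrincipalBibundle EH EM EE H p) (γ : ℝ → E) (g : ℝ → H)
    (α : ℝ → H ≃* H) (t : ℝ) : H ≃* H :=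
  (((phi hp (γ t)).trans (α t)).trans (MulAut.conj (g t))).trans (phi hp (γ 0)).symm

theorem transformedCurve_apply (hp : IsPrincipalBibundle EH EM EE H p) (γ : ℝ → E) (g : ℝ → H)
    (α : ℝ → H ≃* H) (t : ℝ) (h : H) :
    transformedCurve hp γ g α t h =
      (phi hp (γ 0)).symm (g t * α t (phi hp (γ t) h) * (g t)⁻¹) := rfl

theorem contMDiff_smul_curve (hp : IsPrincipalBibundle EH EM EE H p)
    {γ : ℝ → E} {k : ℝ → H} (hγ : ContMDiff 𝓘(ℝ, ℝ) 𝓘(ℝ, EE) ∞ γ) (hk : ContMDiff 𝓘(ℝ, ℝ) 𝓘(ℝ, EH) ∞ k) :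
    ContMDiff 𝓘(ℝ, ℝ) 𝓘(ℝ, EE) ∞ (fun t => k t • γ t) :=
  hp.left.contMDiff_smul.comp (hk.prodMk hγ)

theorem tangentMap_proj_smul (hp : IsPrincipalBibundle EH EM EE H p)
    {γ : ℝ → E} {k : ℝ → H} (hγ : ContMDiff 𝓘(ℝ, ℝ) 𝓘(ℝ, EE) ∞ γ) (hk : ContMDiff 𝓘(ℝ, ℝ) 𝓘(ℝ, EH) ∞ k) :
    tangentMap 𝓘(ℝ, EE) 𝓘(ℝ, EM) p (tvec EE (fun t => k t • γ t)) =
      tangentMap 𝓘(ℝ, EE) 𝓘(ℝ, EM) p (tvec EE γ) := by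
  rw [tangentMap_tvec hp.left.contMDiff_proj.mdiffAt (contMDiff_smul_curve hp hγ hk).mdiffAt,
    tangentMap_tvec hp.left.contMDiff_proj.mdiffAt hγ.mdiffAt]
  simp only [hp.left.proj_smul]

variable [LieGroup 𝓘(ℝ, EH) ∞ H]

theorem contMDiff_phi_curve (hp : IsPrincipalBibundle EH EM EE H p) {γ : ℝ → E}
    (hγ : ContMDiff 𝓘(ℝ, ℝ) 𝓘(ℝ, EE) ∞ γ) :
    ContMDiff (𝓘(ℝ, ℝ).prod 𝓘(ℝ, EH)) 𝓘(ℝ, EH) ∞ (fun q : ℝ × H => phi hp (γ q.1) q.2) :=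
  (contMDiff_phi hp).comp ((hγ.comp contMDiff_fst).prodMk contMDiff_snd)

theorem contMDiff_phi_symm_curve (hp : IsPrincipalBibundle EH EM EE H p) {γ : ℝ → E}
    (hγ : ContMDiff 𝓘(ℝ, ℝ) 𝓘(ℝ, EE) ∞ γ) :
    ContMDiff (𝓘(ℝ, ℝ).prod 𝓘(ℝ, EH)) 𝓘(ℝ, EH) ∞
      (fun q : ℝ × H => (phi hp (γ q.1)).symm q.2) :=
  (contMDiff_phi_symm hp).comp ((hγ.comp contMDiff_fst).prodMk contMDiff_snd)

theorem contMDiff_phi_apply (hp : IsPrincipalBibundle EH EM EE H p) (e : E) :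
    ContMDiff 𝓘(ℝ, EH) 𝓘(ℝ, EH) ∞ (phi hp e) :=
  (contMDiff_phi hp).comp (contMDiff_const.prodMk contMDiff_id)

theorem contMDiff_phi_symm_apply (hp : IsPrincipalBibundle EH EM EE H p) (e : E) :
    ContMDiff 𝓘(ℝ, EH) 𝓘(ℝ, EH) ∞ (phi hp e).symm :=
  (contMDiff_phi_symm hp).comp (contMDiff_const.prodMk contMDiff_id)

theorem isSmoothAutCurve_phi (hp : IsPrincipalBibundle EH EM EE H p) {γ : ℝ → E}
    (hγ : ContMDiff 𝓘(ℝ, ℝ) 𝓘(ℝ, EE) ∞ γ) :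
    IsSmoothAutCurve EH (fun t => (phi hp (γ t)).trans (phi hp (γ 0)).symm) where
  zero := by ext h; simp
  contMDiff := (contMDiff_phi_symm_apply hp _).comp (contMDiff_phi_curve hp hγ)
  contMDiff_symm := (contMDiff_phi_symm_curve hp hγ).comp
    (contMDiff_fst.prodMk ((contMDiff_phi_apply hp _).comp contMDiff_snd))

theorem velocity_phi (hp : IsPrincipalBibundle EH EM EE H p) {γ : ℝ → E}
    (hγ : ContMDiff 𝓘(ℝ, ℝ) 𝓘(ℝ, EE) ∞ γ) :
    velocity EH (fun t => (phi hp (γ t)).trans (phi hp (γ 0)).symm) =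
      phiInvDPhi hp (tvec EE γ) := by
  funext h
  refine (vel_comp_of_eq (f := fun e => (phi hp (γ 0)).symm (phi hp e h)) rfl ?_
    hγ.mdiffAt).symm
  exact ContMDiff.mdiffAt ((contMDiff_phi_symm_apply hp _).comp
    ((contMDiff_phi hp).comp (contMDiff_id.prodMk contMDiff_const)))

variable {a : LieForm EH EE H E} {A : LieAutForm EH EM H M} {γ : ℝ → E} {g k : ℝ → H}
  {α : ℝ → H ≃* H}

/-- The curve is the product of `φ_{γ(0)}⁻¹ Ad_{g(t)} α_t φ_{γ(0)}` and `φ_{γ(0)}⁻¹ φ_{γ(t)}`. Both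
factors start at the identity, so velocities add and give the two summands of the transformed form.
-/
theorem Represents.velocity_transformedCurve (hr : Represents p a A γ g α)
    (hp : IsPrincipalBibundle EH EM EE H p) (hγ : ContMDiff 𝓘(ℝ, ℝ) 𝓘(ℝ, EE) ∞ γ) :
    IsSmoothAutCurve EH (transformedCurve hp γ g α) ∧
      velocity EH (transformedCurve hp γ g α) = transformedForm hp a A (tvec EE γ) := by
  have h1 := (IsSmoothAutCurve.ofCurve hr.contMDiff hr.zero).mul hr.isSmoothAutCurve
  have hf := contMDiff_phi_apply hp (γ 0)
  have hf' := contMDiff_phi_symm_apply hp (γ 0)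
  have h2 := h1.conj hf hf'
  have h3 := isSmoothAutCurve_phi hp hγ
  have heq : transformedCurve hp γ g α = fun t =>
      ((phi hp (γ t)).trans (phi hp (γ 0)).symm).trans
        (((phi hp (γ 0)).trans ((α t).trans (MulAut.conj (g t)))).trans (phi hp (γ 0)).symm) := by
    funext t; ext h
    simp [transformedCurve]
  rw [heq]
  refine ⟨h2.mul h3, ?_⟩
  rw [velocity_mul h2 h3, velocity_conj h1 hf',
    velocity_mul (IsSmoothAutCurve.ofCurve hr.contMDiff hr.zero) hr.isSmoothAutCurve,
    velocity_ofCurve hr.contMDiff hr.zero, velocity_phi hp hγ, hr.vel_eq, hr.velocity_eq,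
    add_comm (ad _ _)]
  rfl

theorem transformedForm_mem (hp : IsPrincipalBibundle EH EM EE H p) (a : LieForm EH EE H E)
    (A : LieAutForm EH EM H M) [IsManifold 𝓘(ℝ, EE) ∞ E] (v : TangentBundle 𝓘(ℝ, EE) E) :
    transformedForm hp a A v ∈ LieAut EH H := by
  obtain ⟨γ, hγ, -, rfl⟩ := exists_curve v Filter.univ_mem
  obtain ⟨g, α, hr⟩ := exists_represents p a A γ
  exact ⟨_, hr.velocity_transformedCurve hp hγ⟩

/-! ### Invariance of the transformed form under `γ ↦ k γ` -/

variable [IsManifold 𝓘(ℝ, EM) ∞ M] [IsManifold 𝓘(ℝ, EE) ∞ E]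

/-- The value of `a` on `[k(t) γ(t)]`. -/
theorem Represents.vel_smul (hr : Represents p a A γ g α)
    (hp : IsPrincipalBibundle EH EM EE H p) (haA : IsTwoConnection p a A)
    (hγ : ContMDiff 𝓘(ℝ, ℝ) 𝓘(ℝ, EE) ∞ γ) (hk : ContMDiff 𝓘(ℝ, ℝ) 𝓘(ℝ, EH) ∞ k) :
    vel EH (fun t => k 0 * g t * α t (k t)⁻¹) = a.eval (tvec EE (fun t => k t • γ t)) := by
  have hα := hr.isSmoothAutCurve
  have hg := hr.contMDiff
  -- the right-hand side
  have hsplit : vel EE (fun t => k t • γ t) =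
      vel EE (fun t => k t • γ 0) + vel EE (fun t => k 0 • γ t) :=
    vel_comp₂ (F := fun q : H × E => q.1 • q.2) hp.left.contMDiff_smul.mdiffAt hk.mdiffAt
      hγ.mdiffAt
  have hadd : a.eval (tvec EE (fun t => k t • γ t)) =
      a.eval (tvec EE (fun t => k t • γ 0)) + a.eval (tvec EE (fun t => k 0 • γ t)) :=
    (congrArg (fun w : EE => (a (k 0 • γ 0) w : EH)) hsplit).trans
      (ContinuousLinearMap.map_add (a (k 0 • γ 0)) _ _)
  -- `k` need not start at `1`: writing `k(t) γ(0) = (k(t) k(0)⁻¹) (k(0) γ(0))` makes the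
  -- Maurer-Cartan axiom applicable at `k(0) γ(0)`.
  have hkk : ContMDiff 𝓘(ℝ, ℝ) 𝓘(ℝ, EH) ∞ (fun t => k t * (k 0)⁻¹) := hk.mul contMDiff_const
  have hA1 : a.eval (tvec EE (fun t => k t • γ 0)) = -vel EH (fun t => k t * (k 0)⁻¹) := by
    refine Eq.trans ?_ (haA.maurerCartan (k 0 • γ 0) (vel EH (fun t => k t * (k 0)⁻¹)))
    rw [← tvec_eq (c := fun t => k t * (k 0)⁻¹) (mul_inv_cancel _), tangentMap_tvec _ hkk.mdiffAt]
    · simp [smul_smul]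
    · exact ContMDiff.mdiffAt (hp.left.contMDiff_smul.comp (contMDiff_id.prodMk contMDiff_const))
  have hA2 : a.eval (tvec EE (fun t => k 0 • γ t)) =
      vel EH (fun t => k 0 * g t * (k 0)⁻¹) + vel EH (fun t => k 0 * α t (k 0)⁻¹) := by
    rw [← tangentMap_tvec (f := fun e : E => k 0 • e) (ContMDiff.mdiffAt
      (hp.left.contMDiff_smul.comp (contMDiff_const.prodMk contMDiff_id))) hγ.mdiffAt,
      haA.equivariance, ← hr.vel_eq, ← hr.velocity_eq]
    exact congrArg₂ (fun x y : EH => x + y) (Ad_vel hr.zero hg _) (T_velocity hα _)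
  -- the left-hand side
  have hB0 : (fun t => k 0 * g t * α t (k t)⁻¹) =
      fun t => (k 0 * g t * (k 0)⁻¹) * (k 0 * α t (k t)⁻¹) := by
    funext t; group
  have hαk : ContMDiff 𝓘(ℝ, ℝ) 𝓘(ℝ, EH) ∞ (fun t => k 0 * α t (k t)⁻¹) :=
    contMDiff_const.mul (hα.contMDiff.comp (contMDiff_id.prodMk hk.inv))
  have hB1 : vel EH (fun t => k 0 * g t * α t (k t)⁻¹) =
      vel EH (fun t => k 0 * g t * (k 0)⁻¹) + vel EH (fun t => k 0 * α t (k t)⁻¹) := by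
    rw [hB0]
    exact vel_mul (ContMDiff.mdiffAt ((contMDiff_const.mul hg).mul contMDiff_const)) hαk.mdiffAt
      (by simp [hr.zero]) (by simp [hα.zero])
  have hB2 : vel EH (fun t => k 0 * α t (k t)⁻¹) =
      vel EH (fun t => k 0 * α t (k 0)⁻¹) + vel EH (fun t => k 0 * (k t)⁻¹) := by
    have := vel_comp₂ (F := fun q : ℝ × H => k 0 * α q.1 q.2) (c := fun t : ℝ => t)
      (d := fun t => (k t)⁻¹) (ContMDiff.mdiffAt (contMDiff_const.mul hα.contMDiff))
      mdifferentiableAt_id hk.inv.mdiffAt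
    simpa only [hα.zero, MulEquiv.refl_apply] using this
  have hB3 : vel EH (fun t => k 0 * (k t)⁻¹) = -vel EH (fun t => k t * (k 0)⁻¹) := by
    rw [← vel_inv (mul_inv_cancel _) hkk]
    simp
  refine (hB1.trans ?_).trans hadd.symm
  refine Eq.trans ?_ (congrArg₂ (fun x y : EH => x + y) hA1 hA2).symm
  rw [hB2, hB3]
  abel

/-- The new `g` encodes both axioms at once: for constant `k` its velocity is `Ad_k a + T_A(k)`, and
for trivial `g` and `α` it is `-[k(t) k(0)⁻¹]`. The curve `α` survives because `p` is constant on
orbits. -/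
theorem Represents.smul (hr : Represents p a A γ g α)
    (hp : IsPrincipalBibundle EH EM EE H p) (haA : IsTwoConnection p a A)
    (hγ : ContMDiff 𝓘(ℝ, ℝ) 𝓘(ℝ, EE) ∞ γ) (hk : ContMDiff 𝓘(ℝ, ℝ) 𝓘(ℝ, EH) ∞ k) :
    Represents p a A (fun t => k t • γ t) (fun t => k 0 * g t * α t (k t)⁻¹) α where
  contMDiff := (contMDiff_const.mul hr.contMDiff).mul
    (hr.isSmoothAutCurve.contMDiff.comp (contMDiff_id.prodMk hk.inv))
  zero := by simp [hr.zero, hr.isSmoothAutCurve.zero]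
  isSmoothAutCurve := hr.isSmoothAutCurve
  vel_eq := hr.vel_smul hp haA hγ hk
  velocity_eq := by rw [tangentMap_proj_smul hp hγ hk, hr.velocity_eq]

/-- The two curves in `Aut(H)` coincide for every `t`. The factor `Ad_{k(t)}` of `φ_{k(t)γ(t)}`
passes through `α_t` and cancels `α_t(k(t)⁻¹)`, while `k(0)` cancels against `φ_{k(0)γ(0)}⁻¹`. -/
theorem transformedForm_smul (hp : IsPrincipalBibundle EH EM EE H p)
    (haA : IsTwoConnection p a A) (hγ : ContMDiff 𝓘(ℝ, ℝ) 𝓘(ℝ, EE) ∞ γ)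
    (hk : ContMDiff 𝓘(ℝ, ℝ) 𝓘(ℝ, EH) ∞ k) :
    transformedForm hp a A (tvec EE (fun t => k t • γ t)) =
      transformedForm hp a A (tvec EE γ) := by
  obtain ⟨g, α, hr⟩ := exists_represents p a A γ
  rw [← (hr.velocity_transformedCurve hp hγ).2,
    ← ((hr.smul hp haA hγ hk).velocity_transformedCurve hp (contMDiff_smul_curve hp hγ hk)).2]
  congr 1
  funext t
  ext h
  simp only [transformedCurve_apply, phi_smul_apply, phi_smul_symm_apply, map_mul, map_inv]
  group

end Transformed

section RightForm

variable {EH EM EE : Type*}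
  [NormedAddCommGroup EH] [NormedSpace ℝ EH]
  [NormedAddCommGroup EM] [NormedSpace ℝ EM]
  [NormedAddCommGroup EE] [NormedSpace ℝ EE]
  {H M E : Type*}
  [TopologicalSpace H] [ChartedSpace EH H] [Group H]
  [TopologicalSpace M] [ChartedSpace EM M]
  [TopologicalSpace E] [ChartedSpace EE E]
  [MulAction H E] [MulAction Hᵐᵒᵖ E] {p : E → M}

/-! ### Linearity of the transformed form -/

theorem conj_add (f : H ≃* H) (X Y : Π h : H, TangentSpace 𝓘(ℝ, EH) h) :
    conj EH f (X + Y) = conj EH f X + conj EH f Y :=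
  funext fun h => (mfderiv 𝓘(ℝ, EH) 𝓘(ℝ, EH) f.symm (f h) : EH →L[ℝ] EH).map_add (X (f h)) (Y (f h))

theorem conj_smul (f : H ≃* H) (r : ℝ) (X : Π h : H, TangentSpace 𝓘(ℝ, EH) h) :
    conj EH f (r • X) = r • conj EH f X :=
  funext fun h => (mfderiv 𝓘(ℝ, EH) 𝓘(ℝ, EH) f.symm (f h) : EH →L[ℝ] EH).map_smul r (X (f h))

theorem ad_add (X Y : GroupLieAlgebra 𝓘(ℝ, EH) H) : ad EH (X + Y) = ad EH X + ad EH Y :=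
  funext fun h => (mfderiv 𝓘(ℝ, EH) 𝓘(ℝ, EH) (fun k => k * h * k⁻¹) (1 : H) :
    EH →L[ℝ] EH).map_add X Y

theorem ad_smul (r : ℝ) (X : GroupLieAlgebra 𝓘(ℝ, EH) H) : ad EH (r • X) = r • ad EH X :=
  funext fun h => (mfderiv 𝓘(ℝ, EH) 𝓘(ℝ, EH) (fun k => k * h * k⁻¹) (1 : H) :
    EH →L[ℝ] EH).map_smul r X

variable [LieGroup 𝓘(ℝ, EH) ∞ H]
  {a : LieForm EH EE H E} {A : LieAutForm EH EM H M}

/-- The transformed form at a point of `E`, as a linear map. -/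
def transformedLinear (hp : IsPrincipalBibundle EH EM EE H p) (a : LieForm EH EE H E)
    (A : LieAutForm EH EM H M) (e : E) :
    TangentSpace 𝓘(ℝ, EE) e →ₗ[ℝ] Π h : H, TangentSpace 𝓘(ℝ, EH) h where
  toFun u := transformedForm hp a A ⟨e, u⟩
  map_add' u w := by
    have h1 : A.eval (tangentMap 𝓘(ℝ, EE) 𝓘(ℝ, EM) p ⟨e, u + w⟩) =
        A.eval (tangentMap 𝓘(ℝ, EE) 𝓘(ℝ, EM) p ⟨e, u⟩) +
          A.eval (tangentMap 𝓘(ℝ, EE) 𝓘(ℝ, EM) p ⟨e, w⟩) :=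
      congrArg Subtype.val ((congrArg (A (p e)) (ContinuousLinearMap.map_add _ u w)).trans
        (LinearMap.map_add (A (p e)) _ _))
    have h2 : a.eval ⟨e, u + w⟩ = a.eval ⟨e, u⟩ + a.eval ⟨e, w⟩ :=
      ContinuousLinearMap.map_add (a e) u w
    have h3 : phiInvDPhi hp ⟨e, u + w⟩ = phiInvDPhi hp ⟨e, u⟩ + phiInvDPhi hp ⟨e, w⟩ :=
      funext fun h => (mfderiv 𝓘(ℝ, EE) 𝓘(ℝ, EH) (fun e' : E => (phi hp e).symm (phi hp e' h)) e :
        EE →L[ℝ] EH).map_add u w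
    unfold transformedForm
    rw [h1, h2, h3, ad_add, add_add_add_comm, conj_add]
    exact add_add_add_comm _ _ _ _
  map_smul' r u := by
    have h1 : A.eval (tangentMap 𝓘(ℝ, EE) 𝓘(ℝ, EM) p ⟨e, r • u⟩) =
        r • A.eval (tangentMap 𝓘(ℝ, EE) 𝓘(ℝ, EM) p ⟨e, u⟩) :=
      congrArg Subtype.val ((congrArg (A (p e)) (ContinuousLinearMap.map_smul _ r u)).trans
        (LinearMap.map_smul (A (p e)) _ _))
    have h2 : a.eval ⟨e, r • u⟩ = r • a.eval ⟨e, u⟩ :=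
      ContinuousLinearMap.map_smul (a e) r u
    have h3 : phiInvDPhi hp ⟨e, r • u⟩ = r • phiInvDPhi hp ⟨e, u⟩ :=
      funext fun h => (mfderiv 𝓘(ℝ, EE) 𝓘(ℝ, EH) (fun e' : E => (phi hp e).symm (phi hp e' h)) e :
        EE →L[ℝ] EH).map_smul r u
    unfold transformedForm
    rw [h1, h2, h3, ad_smul, RingHom.id_apply, smul_add, ← conj_smul, smul_add]

/-- The form `aʳ` on a vector `[c(t)]` on which `a` takes the value `[m(t)]`. -/
theorem rightForm_eval (hp : IsPrincipalBibundle EH EM EE H p) {c : ℝ → E} {m : ℝ → H}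
    (hm : ContMDiff 𝓘(ℝ, ℝ) 𝓘(ℝ, EH) ∞ m) (hm0 : m 0 = 1)
    (h : vel EH m = a.eval (tvec EE c)) :
    (rightForm hp a).eval (tvec EE c) = -vel EH (fun t => (phi hp (c 0)).symm (m t)) := by
  have h1 : (rightForm hp a).eval (tvec EE c) =
    -(diffOne EH (phi hp (c 0)).symm (a.eval (tvec EE c))) := rfl
  rw [h1, ← h]
  exact congrArg (fun w : EH => -w) (diffOne_vel hm0 (contMDiff_phi_symm_apply hp _) hm)

/-! ### Local sections -/

variable [IsManifold 𝓘(ℝ, EM) ∞ M]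

-- As `σ` is a section only over `U`, the identity `p ∘ σ = id` is differentiated along curves that
-- stay in `U`.
omit [LieGroup 𝓘(ℝ, EH) ∞ H] in
theorem tangentMap_proj_section (hp : IsPrincipalBibundle EH EM EE H p) {U : Set M}
    (hU : IsOpen U) {σ : M → E} (hσ : ContMDiffOn 𝓘(ℝ, EM) 𝓘(ℝ, EE) ∞ σ U)
    (hpσ : ∀ y ∈ U, p (σ y) = y) (w : TangentBundle 𝓘(ℝ, EM) M) (hw : w.proj ∈ U) :
    tangentMap 𝓘(ℝ, EE) 𝓘(ℝ, EM) p (tangentMap 𝓘(ℝ, EM) 𝓘(ℝ, EE) σ w) = w := by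
  obtain ⟨c, hc, hcU, rfl⟩ := exists_curve w (hU.mem_nhds hw)
  have hσc : ContMDiff 𝓘(ℝ, ℝ) 𝓘(ℝ, EE) ∞ (fun t => σ (c t)) := fun t =>
    (hσ.contMDiffAt (hU.mem_nhds (hcU t))).comp t (hc t)
  rw [tangentMap_tvec ((hσ.contMDiffAt (hU.mem_nhds (hcU 0))).mdifferentiableAt (by simp))
    hc.mdiffAt, tangentMap_tvec hp.left.contMDiff_proj.mdiffAt hσc.mdiffAt]
  simp only [hpσ _ (hcU _)]

variable [IsManifold 𝓘(ℝ, EE) ∞ E]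

/-- Near every point, `p` has a smooth section, through which the transformed form factors. -/
theorem exists_section (hp : IsPrincipalBibundle EH EM EE H p) (haA : IsTwoConnection p a A)
    (x : M) :
    ∃ U : Set M, IsOpen U ∧ x ∈ U ∧ ∃ σ : M → E, ContMDiffOn 𝓘(ℝ, EM) 𝓘(ℝ, EE) ∞ σ U ∧
      (∀ y ∈ U, p (σ y) = y) ∧ ∀ v : TangentBundle 𝓘(ℝ, EE) E, p v.proj ∈ U →
        transformedForm hp a A (tangentMap 𝓘(ℝ, EM) 𝓘(ℝ, EE) σ
          (tangentMap 𝓘(ℝ, EE) 𝓘(ℝ, EM) p v)) = transformedForm hp a A v := by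
  obtain ⟨U, hU, hxU, Φ, hs, ht, hΦ, hΦ', h1, h2⟩ := hp.left.exists_trivialization x
  have hmem : ∀ y ∈ U, (y, (1 : H)) ∈ Φ.target := fun y hy => by rw [ht]; exact ⟨hy, trivial⟩
  have hσ : ContMDiffOn 𝓘(ℝ, EM) 𝓘(ℝ, EE) ∞ (fun y => Φ.symm (y, (1 : H))) U :=
    hΦ'.comp (contMDiff_id.prodMk contMDiff_const).contMDiffOn hmem
  have hpσ : ∀ y ∈ U, p (Φ.symm (y, (1 : H))) = y := fun y hy => by
    rw [← h1 _ (Φ.map_target (hmem y hy)), Φ.right_inv (hmem y hy)]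
  -- The section has group coordinate `1`, so a point is its own group coordinate times the section.
  -- A curve over `U` is therefore `k(t) σ(p(γ(t)))`, and `transformedForm_smul` removes `k`.
  have hdecomp : ∀ e ∈ Φ.source, (Φ e).2 • Φ.symm (p e, (1 : H)) = e := fun e he => by
    have heU : p e ∈ U := by rw [hs] at he; exact he
    have hsrc := Φ.map_target (hmem _ heU)
    have hsrc' : (Φ e).2 • Φ.symm (p e, (1 : H)) ∈ Φ.source := by
      rw [hs]
      show p _ ∈ U
      rw [hp.left.proj_smul, hpσ _ heU]; exact heU
    refine Φ.injOn hsrc' he (Prod.ext ?_ ?_)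
    · rw [h1 _ hsrc', h1 _ he, hp.left.proj_smul, hpσ _ heU]
    · rw [h2 _ hsrc, Φ.right_inv (hmem _ heU), mul_one]
  refine ⟨U, hU, hxU, _, hσ, hpσ, fun v hv => ?_⟩
  obtain ⟨γ, hγ, hγs, rfl⟩ := exists_curve v
    (Φ.open_source.mem_nhds (show v.proj ∈ Φ.source by rw [hs]; exact hv))
  have hγU : ∀ t, p (γ t) ∈ U := fun t => by have := hγs t; rw [hs] at this; exact this
  have hpγ : ContMDiff 𝓘(ℝ, ℝ) 𝓘(ℝ, EM) ∞ (fun t => p (γ t)) :=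
    hp.left.contMDiff_proj.comp hγ
  have hσγ : ContMDiff 𝓘(ℝ, ℝ) 𝓘(ℝ, EE) ∞ (fun t => Φ.symm (p (γ t), (1 : H))) := fun t =>
    (hσ.contMDiffAt (hU.mem_nhds (hγU t))).comp t (f := fun t => p (γ t)) (hpγ t)
  have hk : ContMDiff 𝓘(ℝ, ℝ) 𝓘(ℝ, EH) ∞ (fun t => (Φ (γ t)).2) := fun t =>
    contMDiffAt_snd.comp t ((hΦ.contMDiffAt (Φ.open_source.mem_nhds (hγs t))).comp t (hγ t))
  rw [tangentMap_tvec hp.left.contMDiff_proj.mdiffAt hγ.mdiffAt,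
    tangentMap_tvec ((hσ.contMDiffAt (hU.mem_nhds (hγU 0))).mdifferentiableAt (by simp))
      hpγ.mdiffAt, ← transformedForm_smul hp haA hσγ hk]
  simp only [hdecomp _ (hγs _)]

/-- At each `x` the form is pulled back by a section chosen for that `x`; no gluing is needed, since
smoothness is proved separately from the defining equation. Uniqueness holds because each `w` is the
projection of `σ_* w`. -/
theorem existsUnique_rightAutForm (hp : IsPrincipalBibundle EH EM EE H p)
    (haA : IsTwoConnection p a A) :
    ∃! Ar : LieAutForm EH EM H M, ∀ v : TangentBundle 𝓘(ℝ, EE) E,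
      Ar.eval (tangentMap 𝓘(ℝ, EE) 𝓘(ℝ, EM) p v) = transformedForm hp a A v := by
  choose U hU hxU σ hσ hpσ hΩ using exists_section hp haA
  refine ⟨fun x => ((transformedLinear hp a A (σ x x)).comp
    (mfderiv 𝓘(ℝ, EM) 𝓘(ℝ, EE) (σ x) x).toLinearMap).codRestrict (LieAut EH H)
      (fun w => transformedForm_mem hp a A _), fun v => hΩ (p v.proj) v (hxU _), ?_⟩
  intro B hB
  funext x
  ext1 w
  refine Subtype.ext ?_
  have h := hB (tangentMap 𝓘(ℝ, EM) 𝓘(ℝ, EE) (σ x) ⟨x, w⟩)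
  rwa [tangentMap_proj_section hp (hU x) (hσ x) (hpσ x) _ (hxU x)] at h

/-! ### The right 2-connection axioms -/

/-- With `Y = [g(t)]`, the identity `e ◁ g(t) = φ_e(g(t)) e` gives the value `-[φ_e(g(t))]` for `a`,
and `-φ_e⁻¹` turns it back into `Y`. -/
theorem rightForm_maurerCartan (hp : IsPrincipalBibundle EH EM EE H p)
    (haA : IsTwoConnection p a A) (e : E) (Y : GroupLieAlgebra 𝓘(ℝ, EH) H) :
    (rightForm hp a).eval
      (tangentMap 𝓘(ℝ, EH) 𝓘(ℝ, EE) (fun h : H => e <• h) ⟨1, Y⟩) = Y := by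
  have : IsManifold 𝓘(ℝ, EH) ∞ H := inferInstance
  obtain ⟨g, hg, -, h⟩ := exists_curve (⟨1, Y⟩ : TangentBundle 𝓘(ℝ, EH) H) Filter.univ_mem
  have hg0 : g 0 = 1 := congrArg (fun v : TangentBundle 𝓘(ℝ, EH) H => v.proj) h
  have hgv : vel EH g = Y := congrArg (fun v : TangentBundle 𝓘(ℝ, EH) H => (v.snd : EH)) h
  have hk : ContMDiff 𝓘(ℝ, ℝ) 𝓘(ℝ, EH) ∞ (fun t => phi hp e (g t)) :=
    (contMDiff_phi_apply hp e).comp hg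
  have hk0 : phi hp e (g 0) = 1 := by rw [hg0, map_one]
  have hcurve : tangentMap 𝓘(ℝ, EH) 𝓘(ℝ, EE) (fun h : H => e <• h) ⟨1, Y⟩ =
      tvec EE (fun t => phi hp e (g t) • e) := by
    rw [← h, tangentMap_tvec (f := fun h : H => e <• h) (ContMDiff.mdiffAt
      (hp.right.contMDiff_smul.comp (contMDiff_const.prodMk contMDiff_id))) hg.mdiffAt]
    simp only [phi_smul]
  have ha : vel EH (fun t => (phi hp e (g t))⁻¹) =
      a.eval (tvec EE (fun t => phi hp e (g t) • e)) := by
    rw [vel_inv hk0 hk]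
    refine (haA.maurerCartan e (vel EH (fun t => phi hp e (g t)))).symm.trans ?_
    rw [← tvec_eq hk0, tangentMap_tvec (f := fun h : H => h • e) (ContMDiff.mdiffAt
      (hp.left.contMDiff_smul.comp (contMDiff_id.prodMk contMDiff_const))) hk.mdiffAt]
  rw [hcurve]
  refine (rightForm_eval hp hk.inv (by simp [hk0]) ha).trans ?_
  simp only [hk0, one_smul, map_inv, MulEquiv.symm_apply_apply]
  rw [vel_inv hg0 hg, neg_neg]
  exact hgv

theorem rightForm_equivariance (hp : IsPrincipalBibundle EH EM EE H p)
    (haA : IsTwoConnection p a A) {Ar : LieAutForm EH EM H M}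
    (hAr : ∀ v : TangentBundle 𝓘(ℝ, EE) E,
      Ar.eval (tangentMap 𝓘(ℝ, EE) 𝓘(ℝ, EM) p v) = transformedForm hp a A v)
    (h : H) (v : TangentBundle 𝓘(ℝ, EE) E) :
    (rightForm hp a).eval (tangentMap 𝓘(ℝ, EE) 𝓘(ℝ, EE) (fun e : E => e <• h) v) =
      Ad EH h⁻¹ ((rightForm hp a).eval v) +
        T EH (Ar.eval (tangentMap 𝓘(ℝ, EE) 𝓘(ℝ, EM) p v)) h⁻¹ := by
  obtain ⟨γ, hγ, -, rfl⟩ := exists_curve v Filter.univ_mem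
  obtain ⟨g, α, hr⟩ := exists_represents p a A γ
  have hα := hr.isSmoothAutCurve
  obtain ⟨hω, hωv⟩ := hr.velocity_transformedCurve hp hγ
  have hf := contMDiff_phi_symm_apply hp (γ 0)
  -- Right translation by `h` multiplies `γ(t)` on the left by `φ_{γ(t)}(h)`, so `Represents.smul`
  -- gives a curve for the translated vector.
  have hk : ContMDiff 𝓘(ℝ, ℝ) 𝓘(ℝ, EH) ∞ (fun t => phi hp (γ t) h) :=
    (contMDiff_phi hp).comp (hγ.prodMk contMDiff_const)
  have hs := hr.smul hp haA hγ hk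
  have hcurve : tangentMap 𝓘(ℝ, EE) 𝓘(ℝ, EE) (fun e : E => e <• h) (tvec EE γ) =
      tvec EE (fun t => phi hp (γ t) h • γ t) := by
    rw [tangentMap_tvec (f := fun e : E => e <• h) (ContMDiff.mdiffAt
      (hp.right.contMDiff_smul.comp (contMDiff_id.prodMk contMDiff_const))) hγ.mdiffAt]
    simp only [phi_smul]
  let a₁ : ℝ → H := fun t => (phi hp (phi hp (γ 0) h • γ 0)).symm
    (phi hp (γ 0) h * g t * α t (phi hp (γ t) h)⁻¹)
  let a₂ : ℝ → H := fun t => h⁻¹ * (phi hp (γ 0)).symm (g t) * h⁻¹⁻¹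
  let a₃ : ℝ → H := fun t => h⁻¹ * transformedCurve hp γ g α t h⁻¹⁻¹
  have ha₁ : ContMDiff 𝓘(ℝ, ℝ) 𝓘(ℝ, EH) ∞ a₁ :=
    (contMDiff_phi_symm_apply hp _).comp hs.contMDiff
  have ha₃ : ContMDiff 𝓘(ℝ, ℝ) 𝓘(ℝ, EH) ∞ a₃ := contMDiff_const.mul (hω.contMDiff_apply _)
  have e1 : (rightForm hp a).eval (tvec EE (fun t => phi hp (γ t) h • γ t)) = -vel EH a₁ :=
    rightForm_eval hp hs.contMDiff hs.zero hs.vel_eq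
  have e2 : Ad EH h⁻¹ ((rightForm hp a).eval (tvec EE γ)) = -vel EH a₂ := by
    rw [rightForm_eval hp hr.contMDiff hr.zero hr.vel_eq]
    refine (ContinuousLinearMap.map_neg _ _).trans (congrArg (fun w : EH => -w) ?_)
    exact Ad_vel (c := fun t => (phi hp (γ 0)).symm (g t)) (by rw [hr.zero, map_one]) (hf.comp hr.contMDiff) _
  have e3 : T EH (Ar.eval (tangentMap 𝓘(ℝ, EE) 𝓘(ℝ, EM) p (tvec EE γ))) h⁻¹ = vel EH a₃ := by
    rw [hAr, ← hωv, T_velocity hω]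
  -- Up to the sign in `aʳ`, `a₁` and `a₂` represent `r^{h*} aʳ` and `Ad_{h⁻¹} aʳ`, and `a₃`
  -- represents `T_{Aʳ}(h⁻¹)`. The axiom is the derivative of this identity.
  have h4 : a₂ = fun t => a₃ t * a₁ t := by
    funext t
    simp only [a₁, a₂, a₃, transformedCurve_apply, phi_smul_symm_apply, map_mul, map_inv,
      MulEquiv.symm_apply_apply, inv_inv]
    group
  have h5 : vel EH a₂ = vel EH a₃ + vel EH a₁ := by
    rw [h4]
    refine vel_mul ha₃.mdiffAt ha₁.mdiffAt ?_ ?_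
    · simp [a₃, hω.zero]
    · simp [a₁, hr.zero, hα.zero]
  rw [hcurve]
  refine e1.trans (Eq.trans ?_ (congrArg₂ (fun x y : EH => x + y) e2 e3).symm)
  rw [h5]
  abel

end RightForm

/-! ### Smoothness of tangent maps depending on parameters -/

section TangentBundle

variable {EN EP EQ : Type*}
  [NormedAddCommGroup EN] [NormedSpace ℝ EN]
  [NormedAddCommGroup EP] [NormedSpace ℝ EP]
  [NormedAddCommGroup EQ] [NormedSpace ℝ EQ]
  {N P Q : Type*}
  [TopologicalSpace N] [ChartedSpace EN N]
  [TopologicalSpace P] [ChartedSpace EP P] [IsManifold 𝓘(ℝ, EP) ∞ P]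
  [TopologicalSpace Q] [ChartedSpace EQ Q]

theorem coordChange_achart_of_eq {x y z : P} (hxy : x = y) (hzx : z = x) (v : EP) :
    (tangentBundleCore 𝓘(ℝ, EP) P).coordChange (achart EP x) (achart EP y) z v = v := by
  subst hxy hzx
  exact (tangentBundleCore 𝓘(ℝ, EP) P).coordChange_self (achart EP z) z (mem_achart_source EP z) v

theorem contMDiff_fiberInclusion (x : P) :
    ContMDiff 𝓘(ℝ, EP) 𝓘(ℝ, EP).tangent ∞
      (fun v : EP => (⟨x, v⟩ : TangentBundle 𝓘(ℝ, EP) P)) := by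
  intro v₀
  rw [Bundle.contMDiffAt_totalSpace]
  refine ⟨contMDiffAt_const, ?_⟩
  have : (fun v : EP => (trivializationAt EP (TangentSpace 𝓘(ℝ, EP)) x
      (⟨x, v⟩ : TangentBundle 𝓘(ℝ, EP) P)).2) = id :=
    funext fun v => coordChange_achart_of_eq rfl rfl v
  exact this ▸ contMDiffAt_id

theorem contMDiff_tangentBundle_add {EK HK K : Type*} [NormedAddCommGroup EK] [NormedSpace ℝ EK]
    [TopologicalSpace HK] {I : ModelWithCorners ℝ EK HK} [TopologicalSpace K] [ChartedSpace HK K]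
    {f : K → P} {X Y : Π y : K, TangentSpace 𝓘(ℝ, EP) (f y)}
    (hX : ContMDiff I 𝓘(ℝ, EP).tangent ∞ (fun y => (⟨f y, X y⟩ : TangentBundle 𝓘(ℝ, EP) P)))
    (hY : ContMDiff I 𝓘(ℝ, EP).tangent ∞ (fun y => (⟨f y, Y y⟩ : TangentBundle 𝓘(ℝ, EP) P))) :
    ContMDiff I 𝓘(ℝ, EP).tangent ∞
      (fun y => (⟨f y, X y + Y y⟩ : TangentBundle 𝓘(ℝ, EP) P)) := by
  intro y₀
  have h1 := Bundle.contMDiffAt_totalSpace.1 (hX y₀)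
  have h2 := Bundle.contMDiffAt_totalSpace.1 (hY y₀)
  rw [Bundle.contMDiffAt_totalSpace]
  refine ⟨h1.1, (h1.2.add h2.2).congr_of_eventuallyEq ?_⟩
  let τ := trivializationAt EP (TangentSpace 𝓘(ℝ, EP)) (f y₀)
  filter_upwards [h1.1.continuousAt.preimage_mem_nhds
    (τ.open_baseSet.mem_nhds (FiberBundle.mem_baseSet_trivializationAt' (f y₀)))] with y hy
  exact (τ.linear ℝ hy).map_add (X y) (Y y)

variable [IsManifold 𝓘(ℝ, EN) ∞ N] [IsManifold 𝓘(ℝ, EQ) ∞ Q]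

/-- The partial tangent map is the full tangent map of `F` precomposed with the zero section in the
first variable. -/
theorem contMDiff_tangentMap_right {F : N × P → Q}
    (hF : ContMDiff (𝓘(ℝ, EN).prod 𝓘(ℝ, EP)) 𝓘(ℝ, EQ) ∞ F) :
    ContMDiff (𝓘(ℝ, EN).prod 𝓘(ℝ, EP).tangent) 𝓘(ℝ, EQ).tangent ∞
      (fun q : N × TangentBundle 𝓘(ℝ, EP) P =>
        tangentMap 𝓘(ℝ, EP) 𝓘(ℝ, EQ) (fun y => F (q.1, y)) q.2) := by
  have : IsManifold 𝓘(ℝ, EN) 1 N := IsManifold.of_le (n := ∞) (by simp)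
  have : IsManifold 𝓘(ℝ, EP) 1 P := IsManifold.of_le (n := ∞) (by simp)
  have : IsManifold 𝓘(ℝ, EQ) 1 Q := IsManifold.of_le (n := ∞) (by simp)
  have h0 : ContMDiff 𝓘(ℝ, EN) 𝓘(ℝ, EN).tangent ∞
      (fun x : N => (⟨x, 0⟩ : TangentBundle 𝓘(ℝ, EN) N)) :=
    Bundle.contMDiff_zeroSection ℝ (TangentSpace 𝓘(ℝ, EN))
  have h1 := (hF.contMDiff_tangentMap (m := ∞) (by simp)).comp
    ((contMDiff_equivTangentBundleProd_symm (n := ∞) (I := 𝓘(ℝ, EN)) (I' := 𝓘(ℝ, EP))).comp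
      ((h0.comp contMDiff_fst).prodMk contMDiff_snd))
  refine h1.congr fun q => ?_
  obtain ⟨x, y, w⟩ := q
  refine congrArg (fun w : EQ => (⟨F (x, y), w⟩ : TangentBundle 𝓘(ℝ, EQ) Q)) ?_
  have h2 : ∀ w : EP, (mfderiv (𝓘(ℝ, EN).prod 𝓘(ℝ, EP)) 𝓘(ℝ, EQ) F (x, y) : EN × EP →L[ℝ] EQ)
      (0, w) = (mfderiv 𝓘(ℝ, EN) 𝓘(ℝ, EQ) (fun z => F (z, y)) x : EN →L[ℝ] EQ) 0 +
        (mfderiv 𝓘(ℝ, EP) 𝓘(ℝ, EQ) (fun z => F (x, z)) y : EP →L[ℝ] EQ) w :=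
    fun w => mfderiv_prod_eq_add_apply (v := ((0 : EN), w)) (hF.mdiffAt (x := (x, y)))
  have h3 := h2 w
  rw [ContinuousLinearMap.map_zero, zero_add] at h3
  exact h3.symm

end TangentBundle

/-! ### Smoothness of the right 2-connection -/

section Smooth

variable {EH EM EE : Type*}
  [NormedAddCommGroup EH] [NormedSpace ℝ EH]
  [NormedAddCommGroup EM] [NormedSpace ℝ EM]
  [NormedAddCommGroup EE] [NormedSpace ℝ EE]
  {H M E : Type*}
  [TopologicalSpace H] [ChartedSpace EH H] [Group H] [LieGroup 𝓘(ℝ, EH) ∞ H]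
  [TopologicalSpace M] [ChartedSpace EM M]
  [TopologicalSpace E] [ChartedSpace EE E]
  [MulAction H E] [MulAction Hᵐᵒᵖ E] {p : E → M}
  {a : LieForm EH EE H E} {A : LieAutForm EH EM H M}

/-- `φ_e⁻¹ dφ` is the image of `dφ` under the differential of `φ_e⁻¹`. -/
theorem phiInvDPhi_eq (hp : IsPrincipalBibundle EH EM EE H p) (v : TangentBundle 𝓘(ℝ, EE) E)
    (h : H) : phiInvDPhi hp v h =
      (mfderiv 𝓘(ℝ, EH) 𝓘(ℝ, EH) (phi hp v.proj).symm (phi hp v.proj h) : EH →L[ℝ] EH)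
        ((mfderiv 𝓘(ℝ, EE) 𝓘(ℝ, EH) (fun e : E => phi hp e h) v.proj : EE →L[ℝ] EH) v.snd) := by
  have h1 : ContMDiff 𝓘(ℝ, EE) 𝓘(ℝ, EH) ∞ (fun e : E => phi hp e h) :=
    (contMDiff_phi hp).comp (contMDiff_id.prodMk contMDiff_const)
  have h2 := mfderiv_comp v.proj (contMDiff_phi_symm_apply hp v.proj).mdiffAt
    (h1.mdiffAt (x := v.proj))
  exact congrArg (fun L : EE →L[ℝ] EH => L v.snd) h2

variable [IsManifold 𝓘(ℝ, EE) ∞ E]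

/-- Derivatives depend smoothly on parameters in tangent coordinates. Since every `φ_e⁻¹` fixes `1`,
source and target base points are always `1`, and the coordinate changes are trivial. -/
theorem contMDiff_diffOne_phi_symm (hp : IsPrincipalBibundle EH EM EE H p) :
    ContMDiff (M' := EH →L[ℝ] EH) 𝓘(ℝ, EE) 𝓘(ℝ, EH →L[ℝ] EH) ∞
      (fun e : E => (diffOne EH (phi hp e).symm : EH →L[ℝ] EH)) := by
  have : IsManifold 𝓘(ℝ, EH) ∞ H := inferInstance
  have : IsManifold 𝓘(ℝ, EH) 1 H := IsManifold.of_le (n := ∞) (by simp)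
  have : IsManifold 𝓘(ℝ, EE) 1 E := IsManifold.of_le (n := ∞) (by simp)
  intro e₀
  have h := ContMDiffAt.mfderiv (I := 𝓘(ℝ, EH)) (I' := 𝓘(ℝ, EH)) (m := ∞) (n := ∞)
    (fun (e : E) (h : H) => (phi hp e).symm h) (fun _ => (1 : H)) (x₀ := e₀)
    (contMDiff_phi_symm hp _) contMDiffAt_const (by simp)
  refine h.congr_of_eventuallyEq (Filter.Eventually.of_forall fun e => ?_)
  have hsource : (phi hp e).symm 1 ∈ (chartAt EH ((phi hp e₀).symm 1)).source := by
    rw [map_one, map_one]; exact mem_chart_source EH _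
  have hcoord := inTangentCoordinates_eq (I := 𝓘(ℝ, EH)) (I' := 𝓘(ℝ, EH)) (fun _ : E => (1 : H))
    (fun e => (phi hp e).symm 1) (fun e => (diffOne EH (phi hp e).symm : EH →L[ℝ] EH))
    (x₀ := e₀) (x := e) (mem_chart_source EH _) hsource
  refine Eq.trans ?_ hcoord.symm
  refine ContinuousLinearMap.ext fun v => Eq.symm ?_
  refine (coordChange_achart_of_eq (EP := EH) (by simp) rfl _).trans ?_
  exact congrArg (diffOne EH (phi hp e).symm : EH →L[ℝ] EH) 
    (coordChange_achart_of_eq (EP := EH) (x := (1 : H)) rfl rfl v)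

theorem rightForm_isSmooth (hp : IsPrincipalBibundle EH EM EE H p) (ha : a.IsSmooth) :
    (rightForm hp a).IsSmooth := by
  have h1 : ContMDiff (M' := EH →L[ℝ] EH) 𝓘(ℝ, EE).tangent 𝓘(ℝ, EH →L[ℝ] EH) ∞
      (fun v : TangentBundle 𝓘(ℝ, EE) E => (diffOne EH (phi hp v.proj).symm : EH →L[ℝ] EH)) :=
    (contMDiff_diffOne_phi_symm hp).comp (Bundle.contMDiff_proj _)
  exact (contDiff_neg.contMDiff (n := ∞)).comp (h1.clm_apply ha)

variable [IsManifold 𝓘(ℝ, EM) ∞ M]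

/-- All three terms are images under the differential of `φ_e⁻¹` of vectors based at `φ_e(h)`, so
they are added there before that differential is applied. -/
theorem contMDiff_transformedForm (hp : IsPrincipalBibundle EH EM EE H p)
    (haA : IsTwoConnection p a A) :
    ContMDiff (𝓘(ℝ, EE).tangent.prod 𝓘(ℝ, EH)) 𝓘(ℝ, EH).tangent ∞
      (fun q : TangentBundle 𝓘(ℝ, EE) E × H =>
        (⟨q.2, transformedForm hp a A q.1 q.2⟩ : TangentBundle 𝓘(ℝ, EH) H)) := by
  have : IsManifold 𝓘(ℝ, EH) ∞ H := inferInstance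
  have : IsManifold 𝓘(ℝ, EE) 1 E := IsManifold.of_le (n := ∞) (by simp)
  have : IsManifold 𝓘(ℝ, EM) 1 M := IsManifold.of_le (n := ∞) (by simp)
  have hproj : ContMDiff (𝓘(ℝ, EE).tangent.prod 𝓘(ℝ, EH)) 𝓘(ℝ, EE) ∞
      (fun q : TangentBundle 𝓘(ℝ, EE) E × H => q.1.proj) :=
    (Bundle.contMDiff_proj _).comp contMDiff_fst
  have hφ : ContMDiff (𝓘(ℝ, EE).tangent.prod 𝓘(ℝ, EH)) 𝓘(ℝ, EH) ∞
      (fun q : TangentBundle 𝓘(ℝ, EE) E × H => phi hp q.1.proj q.2) :=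
    (contMDiff_phi hp).comp (hproj.prodMk contMDiff_snd)
  have hA : ContMDiff (𝓘(ℝ, EE).tangent.prod 𝓘(ℝ, EH)) 𝓘(ℝ, EH).tangent ∞
      (fun q : TangentBundle 𝓘(ℝ, EE) E × H => (⟨phi hp q.1.proj q.2,
        A.eval (tangentMap 𝓘(ℝ, EE) 𝓘(ℝ, EM) p q.1) (phi hp q.1.proj q.2)⟩ :
          TangentBundle 𝓘(ℝ, EH) H)) :=
    haA.smooth_A.comp (((hp.left.contMDiff_proj.contMDiff_tangentMap (m := ∞) (by simp)).comp
      contMDiff_fst).prodMk hφ)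
  have hAd : ContMDiff (𝓘(ℝ, EH).prod 𝓘(ℝ, EH)) 𝓘(ℝ, EH) ∞
      (fun q : H × H => q.2 * q.1 * q.2⁻¹) :=
    (contMDiff_snd.mul contMDiff_fst).mul contMDiff_snd.inv
  have had : ContMDiff (𝓘(ℝ, EE).tangent.prod 𝓘(ℝ, EH)) 𝓘(ℝ, EH).tangent ∞
      (fun q : TangentBundle 𝓘(ℝ, EE) E × H => (⟨phi hp q.1.proj q.2,
        ad EH (a.eval q.1) (phi hp q.1.proj q.2)⟩ : TangentBundle 𝓘(ℝ, EH) H)) := by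
    refine ((contMDiff_tangentMap_right hAd).comp
      (hφ.prodMk ((contMDiff_fiberInclusion (1 : H)).comp
        (haA.smooth_a.comp contMDiff_fst)))).congr fun q => ?_
    refine Bundle.TotalSpace.ext ?_ ?_
    · simp [tangentMap]
    · exact HEq.rfl
  have hdφ : ContMDiff (𝓘(ℝ, EE).tangent.prod 𝓘(ℝ, EH)) 𝓘(ℝ, EH).tangent ∞
      (fun q : TangentBundle 𝓘(ℝ, EE) E × H => (⟨phi hp q.1.proj q.2,
        (mfderiv 𝓘(ℝ, EE) 𝓘(ℝ, EH) (fun e : E => phi hp e q.2) q.1.proj : EE →L[ℝ] EH) q.1.snd⟩ :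
          TangentBundle 𝓘(ℝ, EH) H)) :=
    (contMDiff_tangentMap_right (F := fun q : H × E => phi hp q.2 q.1)
      ((contMDiff_phi hp).comp (contMDiff_snd.prodMk contMDiff_fst))).comp
        (contMDiff_snd.prodMk contMDiff_fst)
  have hsum := contMDiff_tangentBundle_add (contMDiff_tangentBundle_add hA had) hdφ
  refine ((contMDiff_tangentMap_right (contMDiff_phi_symm hp)).comp
    (hproj.prodMk hsum)).congr fun q => ?_
  obtain ⟨v, h⟩ := q
  refine Bundle.TotalSpace.ext (by simp [tangentMap]) (heq_of_eq ?_)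
  refine (congrArg (fun w : TangentSpace 𝓘(ℝ, EH) h => conj EH (phi hp v.proj)
    (A.eval (tangentMap 𝓘(ℝ, EE) 𝓘(ℝ, EM) p v) + ad EH (a.eval v)) h + w)
      (phiInvDPhi_eq hp v h)).trans ?_
  exact (ContinuousLinearMap.map_add (mfderiv 𝓘(ℝ, EH) 𝓘(ℝ, EH) (phi hp v.proj).symm
    (phi hp v.proj h) : EH →L[ℝ] EH) _ _).symm

/-- Over the domain of a smooth section `σ`, the defining equation evaluated on `σ_* w` expresses
`Aʳ(w)` as the transformed form at `σ_* w`. -/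
theorem rightAutForm_isSmooth (hp : IsPrincipalBibundle EH EM EE H p)
    (haA : IsTwoConnection p a A) {Ar : LieAutForm EH EM H M}
    (hAr : ∀ v : TangentBundle 𝓘(ℝ, EE) E,
      Ar.eval (tangentMap 𝓘(ℝ, EE) 𝓘(ℝ, EM) p v) = transformedForm hp a A v) :
    Ar.IsSmooth := by
  have : IsManifold 𝓘(ℝ, EE) 1 E := IsManifold.of_le (n := ∞) (by simp)
  have : IsManifold 𝓘(ℝ, EM) 1 M := IsManifold.of_le (n := ∞) (by simp)
  rintro ⟨w₀, h₀⟩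
  obtain ⟨U, hU, hxU, σ, hσ, hpσ, -⟩ := exists_section hp haA w₀.proj
  have hproj : Continuous (fun w : TangentBundle 𝓘(ℝ, EM) M => w.proj) :=
    FiberBundle.continuous_proj _ _
  have hV : IsOpen ((fun w : TangentBundle 𝓘(ℝ, EM) M => w.proj) ⁻¹' U) := hU.preimage hproj
  have hσT : ContMDiffAt 𝓘(ℝ, EM).tangent 𝓘(ℝ, EE).tangent ∞
      (tangentMap 𝓘(ℝ, EM) 𝓘(ℝ, EE) σ) w₀ := by
    have h := ((hσ.contMDiffOn_tangentMapWithin (m := ∞) (by simp) hU.uniqueMDiffOn) w₀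
      hxU).contMDiffAt (hV.mem_nhds hxU)
    -- `σ` is smooth only on `U`; as `U` is open, the derivative within `U` is the full one there.
    refine h.congr_of_eventuallyEq ?_
    filter_upwards [hV.mem_nhds hxU] with w hw
    exact (tangentMapWithin_eq_tangentMap (hU.uniqueMDiffOn _ hw)
      ((hσ.contMDiffAt (hU.mem_nhds hw)).mdifferentiableAt (by simp))).symm
  have h1 := (contMDiff_transformedForm hp haA
    (tangentMap 𝓘(ℝ, EM) 𝓘(ℝ, EE) σ w₀, h₀)).comp (w₀, h₀)
      (f := fun q : TangentBundle 𝓘(ℝ, EM) M × H => (tangentMap 𝓘(ℝ, EM) 𝓘(ℝ, EE) σ q.1, q.2))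
      ((hσT.comp (w₀, h₀) (f := Prod.fst) contMDiffAt_fst).prodMk contMDiffAt_snd)
  refine h1.congr_of_eventuallyEq ?_
  have hfst : ContinuousAt (fun q : TangentBundle 𝓘(ℝ, EM) M × H => q.1) (w₀, h₀) :=
    continuousAt_fst
  filter_upwards [hfst.preimage_mem_nhds (hV.mem_nhds hxU)] with q hq
  have h := hAr (tangentMap 𝓘(ℝ, EM) 𝓘(ℝ, EE) σ q.1)
  rw [tangentMap_proj_section hp hU hσ hpσ _ hq] at h
  exact congrArg (fun X : Π h : H, TangentSpace 𝓘(ℝ, EH) h =>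
    (⟨q.2, X q.2⟩ : TangentBundle 𝓘(ℝ, EH) H)) h

end Smooth

end Bibundle

end

theorem mainTheorem3
    {EH EM EE : Type*}
    [NormedAddCommGroup EH] [NormedSpace ℝ EH] [FiniteDimensional ℝ EH]
    [NormedAddCommGroup EM] [NormedSpace ℝ EM] [FiniteDimensional ℝ EM]
    [NormedAddCommGroup EE] [NormedSpace ℝ EE] [FiniteDimensional ℝ EE]
    {H M E : Type*}
    [TopologicalSpace H] [ChartedSpace EH H] [Group H] [LieGroup 𝓘(ℝ, EH) ∞ H]
    [TopologicalSpace M] [ChartedSpace EM M] [IsManifold 𝓘(ℝ, EM) ∞ M]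
    [TopologicalSpace E] [ChartedSpace EE E] [IsManifold 𝓘(ℝ, EE) ∞ E]
    [MulAction H E] [MulAction Hᵐᵒᵖ E] {p : E → M}
    (hp : Bibundle.IsPrincipalBibundle EH EM EE H p)
    (a : Bibundle.LieForm EH EE H E) (A : Bibundle.LieAutForm EH EM H M)
    (haA : Bibundle.IsTwoConnection p a A) :
    (∃! Ar : Bibundle.LieAutForm EH EM H M,
      ∀ v : TangentBundle 𝓘(ℝ, EE) E,
        Ar.eval (tangentMap 𝓘(ℝ, EE) 𝓘(ℝ, EM) p v) = Bibundle.transformedForm hp a A v) ∧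
    ∀ Ar : Bibundle.LieAutForm EH EM H M,
      (∀ v : TangentBundle 𝓘(ℝ, EE) E,
        Ar.eval (tangentMap 𝓘(ℝ, EE) 𝓘(ℝ, EM) p v) = Bibundle.transformedForm hp a A v) →
      Bibundle.IsRightTwoConnection p (Bibundle.rightForm hp a) Ar := by
  refine ⟨Bibundle.existsUnique_rightAutForm hp haA, fun Ar hAr => ?_⟩
  exact
    { smooth_a := Bibundle.rightForm_isSmooth hp haA.smooth_a
      smooth_A := Bibundle.rightAutForm_isSmooth hp haA hAr
      maurerCartan := Bibundle.rightForm_maurerCartan hp haA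
      equivariance := Bibundle.rightForm_equivariance hp haA hAr }
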